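/- Let $A_1,A_2:\mathbb R^2\to\mathbb R$ be $C^1$ functions and let $B=\frac{\partial A_2}{\partial x}-\frac{\partial A_1}{\partial y}$ be the associated magnetic field. Let $\mathbb D$ be the Dirac operator in $L^2(\mathbb R^2,\mathbb C^2)$, i.e. the operator closure of $$\sigma_1\Big(-i\frac{\partial}{\partial x}-A_1\Big)+\sigma_2\Big(-i\frac{\partial}{\partial y}-A_2\Big),\qquad \sigma_1=\begin{pmatrix}0&1\\1&0\end{pmatrix},\quad \sigma_2=\begin{pmatrix}0&-i\\ i&0\end{pmatrix},$$ acting on $C_0^\infty(\mathbb R^2)\oplus C_0^\infty(\mathbb R^2)$. Suppose that there is a $C^2$ function $\varphi:\mathbb R^2\to\mathbb R$ with $B=\Delta\varphi$ which is bounded from above or bounded from below. Then $\mathbb D$ is self-adjoint and does not have compact resolvent: for every $\lambda\in\mathbb C\setminus\sigma(\mathbb D)$ the resolvent $(\mathbb D-\lambda)^{-1}$ is not a compact operator. -/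

import Mathlib

open MeasureTheory
open scoped ContDiff

/-- The Euclidean plane `ℝ²`. -/
abbrev Plane : Type := EuclideanSpace ℝ (Fin 2)

/-- The spinor space `ℂ²`, with its Hermitian norm. -/
abbrev Spinor : Type := EuclideanSpace ℂ (Fin 2)

/-- The Hilbert space `L²(ℝ², ℂ²)` for Lebesgue measure. -/
abbrev SpinorL2 : Type := Lp Spinor 2 (volume : Measure Plane)

noncomputable section

/-- The partial derivative `∂f/∂x_j` at `p`; coordinate `0` is `x` and coordinate `1` is `y`. -/
def partialDeriv {F : Type*} [NormedAddCommGroup F] [NormedSpace ℝ F]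
    (j : Fin 2) (f : Plane → F) (p : Plane) : F :=
  fderiv ℝ f p (EuclideanSpace.single j 1)

/-- The magnetic field `B = ∂A₂/∂x - ∂A₁/∂y`. -/
def magneticField (A₁ A₂ : Plane → ℝ) (p : Plane) : ℝ :=
  partialDeriv 0 A₂ p - partialDeriv 1 A₁ p

/-- The first Pauli matrix. -/
def pauli₁ : Matrix (Fin 2) (Fin 2) ℂ := !![0, 1; 1, 0]

/-- The second Pauli matrix. -/
def pauli₂ : Matrix (Fin 2) (Fin 2) ℂ := !![0, -Complex.I; Complex.I, 0]

/-- The covariant derivative `(-i ∂/∂x_j - A) ψ`. -/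
def covariantDeriv (j : Fin 2) (A : Plane → ℝ) (ψ : Plane → Spinor) (p : Plane) : Spinor :=
  -Complex.I • partialDeriv j ψ p - (A p : ℂ) • ψ p

/-- The Dirac expression `σ₁ (-i ∂/∂x - A₁) ψ + σ₂ (-i ∂/∂y - A₂) ψ`. -/
def diracExpr (A₁ A₂ : Plane → ℝ) (ψ : Plane → Spinor) (p : Plane) : Spinor :=
  Matrix.toEuclideanLin pauli₁ (covariantDeriv 0 A₁ ψ p) +
    Matrix.toEuclideanLin pauli₂ (covariantDeriv 1 A₂ ψ p)

/-- The space `C₀^∞(ℝ²) ⊕ C₀^∞(ℝ²)` of smooth compactly supported spinor fields. -/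
def testSpinors : Submodule ℂ (Plane → Spinor) where
  carrier := {ψ | ContDiff ℝ ∞ ψ ∧ HasCompactSupport ψ}
  add_mem' := fun ha hb => ⟨ha.1.add hb.1, ha.2.add hb.2⟩
  zero_mem' := ⟨contDiff_const, HasCompactSupport.zero⟩
  smul_mem' := fun c _ ha => ⟨ha.1.const_smul c, ha.2.smul_left (f := fun _ => c)⟩

theorem testSpinors_memLp (ψ : testSpinors) :
    MemLp (ψ : Plane → Spinor) 2 (volume : Measure Plane) :=
  ψ.2.1.continuous.memLp_of_hasCompactSupport ψ.2.2

/-- The inclusion of the test spinors in `L²`. -/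
def testToL2 : testSpinors →ₗ[ℂ] SpinorL2 where
  toFun ψ := (testSpinors_memLp ψ).toLp _
  map_add' _ _ := rfl
  map_smul' _ _ := rfl

theorem testToL2_injective : Function.Injective testToL2 := by
  intro a b h
  have h' : (a : Plane → Spinor) =ᵐ[volume] (b : Plane → Spinor) :=
    (MemLp.toLp_eq_toLp_iff (testSpinors_memLp a) (testSpinors_memLp b)).1 h
  exact Subtype.ext ((a.2.1.continuous.ae_eq_iff_eq volume b.2.1.continuous).1 h')

theorem diracExpr_memLp {A₁ A₂ : Plane → ℝ} (h₁ : Continuous A₁) (h₂ : Continuous A₂)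
    (ψ : testSpinors) :
    MemLp (diracExpr A₁ A₂ ψ) 2 (volume : Measure Plane) := by
  have hc : ∀ (j : Fin 2) (A : Plane → ℝ), Continuous A →
      Continuous (covariantDeriv j A ψ) ∧ HasCompactSupport (covariantDeriv j A ψ) := by
    intro j A hA
    have hd : Continuous (partialDeriv j (ψ : Plane → Spinor)) :=
      (ψ.2.1.continuous_fderiv (by simp)).clm_apply continuous_const
    have hs : HasCompactSupport (partialDeriv j (ψ : Plane → Spinor)) :=
      ψ.2.2.fderiv_apply ℝ _
    refine ⟨(hd.const_smul (-Complex.I)).sub ((Complex.continuous_ofReal.comp hA).smul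
      ψ.2.1.continuous), ?_⟩
    exact (hs.smul_left (f := fun _ => -Complex.I)).sub
      (ψ.2.2.smul_left (f := fun p => (A p : ℂ)))
  have hL : ∀ M : Matrix (Fin 2) (Fin 2) ℂ, Continuous (Matrix.toEuclideanLin M) :=
    fun M => LinearMap.continuous_of_finiteDimensional _
  have e₁ := hc 0 A₁ h₁
  have e₂ := hc 1 A₂ h₂
  exact (((hL pauli₁).comp e₁.1).add ((hL pauli₂).comp e₂.1)).memLp_of_hasCompactSupport
    ((e₁.2.comp_left (map_zero _)).add (e₂.2.comp_left (map_zero _)))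

/-- The Dirac expression as a linear map from the test spinors to `L²`. -/
def diracOnTest (A₁ A₂ : Plane → ℝ) (h₁ : Continuous A₁) (h₂ : Continuous A₂) :
    testSpinors →ₗ[ℂ] SpinorL2 where
  toFun ψ := (diracExpr_memLp h₁ h₂ ψ).toLp _
  map_add' a b := by
    rw [← MemLp.toLp_add]
    congr 1
    funext p
    have ha := (a.2.1.differentiable (by simp)) p
    have hb := (b.2.1.differentiable (by simp)) p
    simp only [diracExpr, covariantDeriv, partialDeriv, Submodule.coe_add, Pi.add_apply,
      fderiv_add ha hb, _root_.add_apply, smul_add, map_add, map_sub]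
    abel
  map_smul' c a := by
    rw [RingHom.id_apply, ← MemLp.toLp_const_smul]
    congr 1
    funext p
    have ha := (a.2.1.differentiable (by simp)) p
    simp only [diracExpr, covariantDeriv, partialDeriv, Submodule.coe_smul, Pi.smul_apply,
      fderiv_const_smul ha, _root_.smul_apply, smul_add, map_sub, smul_sub,
      map_smul, smul_comm c]

/-- The Dirac operator with domain `C₀^∞(ℝ²) ⊕ C₀^∞(ℝ²)`, as an unbounded operator in `L²`. -/
def diracMin (A₁ A₂ : Plane → ℝ) (h₁ : Continuous A₁) (h₂ : Continuous A₂) :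
    SpinorL2 →ₗ.[ℂ] SpinorL2 where
  domain := LinearMap.range testToL2
  toFun := diracOnTest A₁ A₂ h₁ h₂ ∘ₗ
    (LinearEquiv.ofInjective testToL2 testToL2_injective).symm.toLinearMap

/-- The Dirac operator `𝔻`: the operator closure of the Dirac operator on
`C₀^∞(ℝ²) ⊕ C₀^∞(ℝ²)`. -/
def diracOperator (A₁ A₂ : Plane → ℝ) (h₁ : Continuous A₁) (h₂ : Continuous A₂) :
    SpinorL2 →ₗ.[ℂ] SpinorL2 :=
  (diracMin A₁ A₂ h₁ h₂).closure

end

/-- `R` is the resolvent `(T - z)⁻¹`: the bounded, everywhere defined, two-sided inverse of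
`T - z : dom T → H`. Thus `z` lies outside the spectrum of `T` iff such an `R` exists. -/
def IsResolventAt {H : Type*} [NormedAddCommGroup H] [NormedSpace ℂ H]
    (T : H →ₗ.[ℂ] H) (z : ℂ) (R : H →L[ℂ] H) : Prop :=
  (∀ f : H, ∃ h : R f ∈ T.domain, T ⟨R f, h⟩ - z • R f = f) ∧
    ∀ u : T.domain, R (T u - z • (u : H)) = u

/-- The spectrum of an unbounded operator `T`. -/
def unboundedSpectrum {H : Type*} [NormedAddCommGroup H] [NormedSpace ℂ H]
    (T : H →ₗ.[ℂ] H) : Set ℂ :=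
  {z | ¬ ∃ R : H →L[ℂ] H, IsResolventAt T z R}

-- Self-adjointness needs no growth condition on `A`. The Dirac expression is of first order, so its
-- commutator with a function `θ` is multiplication by `-i σ(∇θ)`, which does not involve `A`. A
-- pair `(u, v)` in the adjoint graph can therefore be cut off by `θ(p / (n + 1))` at a cost of
-- order `1/n`. A cut-off pair is mollified: on a bounded set `σ · A` is a bounded term that can be
-- moved to the right-hand side, and the remaining constant-coefficient operator commutes with
-- convolution. Hence the adjoint lies in the closure of the minimal operator
-- (`adjoint_graph_le_closure`).
--
-- For the resolvent, compactness would make `𝔻` coercive at infinity: for every `C`, `‖𝔻u‖ ≥ C‖u‖`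
-- once `u` is supported far enough out (`exists_forall_mul_integral_le`). This is tested on cut-off
-- zero modes. Since `B = Δφ`, for `s = ±1` a gauge function `γ` gives the solution `exp(iγ - sφ) (x
-- + isy)^m` in one spinor component (`exists_zeroMode`), with squared modulus `exp(-2sφ) |p|^(2m)`.
-- The sign `s` is chosen so that this grows at most polynomially.
--
-- Let `F n` be the mass of the zero mode in the annulus `n ≤ |p| < n + 1`. Cutting off to annuli
-- and using coercivity with a large constant gives `3 F(n) ≤ F(n-1) + F(n+1)` for large `n`. The
-- coercivity radius `N` does not depend on `m`, so `m` can be taken large enough that `F(N) ≤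
-- F(N+2)`. The recursion then forces exponential growth of `F` (`false_of_three_mul_le`),
-- contradicting the polynomial bound.

local notation "⟪" x ", " y "⟫" => inner ℂ x y

noncomputable section

/-! ### Pointwise algebra of the Dirac expression -/

/-- The Pauli matrices as continuous linear maps on the spinor space. -/
def pauliMap (j : Fin 2) : Spinor →L[ℂ] Spinor :=
  LinearMap.toContinuousLinearMap (Matrix.toEuclideanLin (![pauli₁, pauli₂] j))

theorem pauliMap_zero_apply (w : Spinor) : pauliMap 0 w = !₂[w 1, w 0] := by
  ext i
  fin_cases i <;>
    simp [pauliMap, pauli₁, Matrix.toLpLin_apply, dotProduct, Fin.sum_univ_two]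

theorem pauliMap_one_apply (w : Spinor) :
    pauliMap 1 w = !₂[-Complex.I * w 1, Complex.I * w 0] := by
  ext i
  fin_cases i <;>
    simp [pauliMap, pauli₂, Matrix.toLpLin_apply, dotProduct, Fin.sum_univ_two]

theorem norm_pauliMap_apply (j : Fin 2) (w : Spinor) : ‖pauliMap j w‖ = ‖w‖ := by
  fin_cases j <;>
    simp [pauliMap_zero_apply, pauliMap_one_apply, EuclideanSpace.norm_eq, Fin.sum_univ_two,
      add_comm]

theorem inner_pauliMap_left (j : Fin 2) (v w : Spinor) :
    ⟪pauliMap j v, w⟫ = ⟪v, pauliMap j w⟫ := by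
  fin_cases j <;>
    simp [pauliMap_zero_apply, pauliMap_one_apply, PiLp.inner_apply, Fin.sum_univ_two] <;> ring

theorem diracExpr_eq_sum (A₁ A₂ : Plane → ℝ) (ψ : Plane → Spinor) (p : Plane) :
    diracExpr A₁ A₂ ψ p = ∑ j, pauliMap j (covariantDeriv j (![A₁, A₂] j) ψ p) := by
  simp [diracExpr, Fin.sum_univ_two, pauliMap]

/-- The commutator `-i σ(∇θ)` of the Dirac expression with a function `θ`, applied to `ψ`. -/
def diracCommutator (θ : Plane → ℝ) (ψ : Plane → Spinor) (p : Plane) : Spinor :=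
  ∑ j, (-Complex.I * ((partialDeriv j θ p : ℝ) : ℂ)) • pauliMap j (ψ p)

/-- Leibniz rule. The potential enters without derivatives and so drops out of the commutator; this
makes cutoffs cheap whatever the size of `A`. -/
theorem diracExpr_smul {A₁ A₂ : Plane → ℝ} {θ : Plane → ℝ} {ψ : Plane → Spinor} {p : Plane}
    (hθ : DifferentiableAt ℝ θ p) (hψ : DifferentiableAt ℝ ψ p) :
    diracExpr A₁ A₂ (fun q => (θ q : ℂ) • ψ q) p =
      (θ p : ℂ) • diracExpr A₁ A₂ ψ p + diracCommutator θ ψ p := by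
  simp only [diracExpr_eq_sum, diracCommutator, Finset.smul_sum, ← Finset.sum_add_distrib]
  refine Finset.sum_congr rfl fun j _ => ?_
  have hd : partialDeriv j (fun q => (θ q : ℂ) • ψ q) p =
      (θ p : ℂ) • partialDeriv j ψ p + ((partialDeriv j θ p : ℝ) : ℂ) • ψ p := by
    have h : (fun q => (θ q : ℂ) • ψ q) = fun q => θ q • ψ q := by
      funext q; exact Complex.coe_smul _ _
    simp only [partialDeriv, h]
    rw [fderiv_fun_smul hθ hψ]
    simp [Complex.coe_smul]
  rw [covariantDeriv, covariantDeriv, hd]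
  simp only [map_sub, map_smul, smul_sub, smul_add, map_add, smul_smul]
  rw [mul_comm (θ p : ℂ) (-Complex.I), mul_comm ((![A₁, A₂] j p : ℝ) : ℂ)]
  abel

theorem norm_partialDeriv_le {F : Type*} [NormedAddCommGroup F] [NormedSpace ℝ F] (j : Fin 2)
    (f : Plane → F) (p : Plane) : ‖partialDeriv j f p‖ ≤ ‖fderiv ℝ f p‖ := by
  simpa [partialDeriv] using (fderiv ℝ f p).le_opNorm (EuclideanSpace.single j 1)

theorem norm_diracCommutator_le (θ : Plane → ℝ) (ψ : Plane → Spinor) (p : Plane) :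
    ‖diracCommutator θ ψ p‖ ≤ 2 * ‖fderiv ℝ θ p‖ * ‖ψ p‖ := by
  refine (norm_sum_le _ _).trans ?_
  have h : ∀ j : Fin 2, ‖(-Complex.I * ((partialDeriv j θ p : ℝ) : ℂ)) • pauliMap j (ψ p)‖ ≤
      ‖fderiv ℝ θ p‖ * ‖ψ p‖ := fun j => by
    rw [norm_smul, norm_pauliMap_apply]
    gcongr
    simpa using norm_partialDeriv_le j θ p
  rw [Fin.sum_univ_two]
  linarith [h 0, h 1]

/-- The Pauli matrices are Hermitian and the scalar `-i ∂_j θ` is purely imaginary. This is what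
carries the Leibniz rule over to distributions. -/
theorem inner_diracCommutator_left (θ : Plane → ℝ) (u ψ : Plane → Spinor) (p : Plane) :
    ⟪diracCommutator θ u p, ψ p⟫ = -⟪u p, diracCommutator θ ψ p⟫ := by
  simp only [diracCommutator, sum_inner, inner_sum, ← Finset.sum_neg_distrib]
  refine Finset.sum_congr rfl fun j _ => ?_
  rw [inner_smul_left, inner_smul_right, inner_pauliMap_left]
  simp

theorem continuous_partialDeriv {F : Type*} [NormedAddCommGroup F] [NormedSpace ℝ F] (j : Fin 2)
    {f : Plane → F} (hf : ContDiff ℝ 1 f) : Continuous (partialDeriv j f) :=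
  (hf.continuous_fderiv (by simp)).clm_apply continuous_const

theorem continuous_covariantDeriv {j : Fin 2} {A : Plane → ℝ} {ψ : Plane → Spinor}
    (hA : Continuous A) (hψ : ContDiff ℝ 1 ψ) : Continuous (covariantDeriv j A ψ) :=
  ((continuous_partialDeriv j hψ).const_smul (-Complex.I)).sub
    ((Complex.continuous_ofReal.comp hA).smul hψ.continuous)

theorem HasCompactSupport.partialDeriv {F : Type*} [NormedAddCommGroup F] [NormedSpace ℝ F]
    (j : Fin 2) {f : Plane → F} (hf : HasCompactSupport f) :
    HasCompactSupport (partialDeriv j f) :=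
  hf.fderiv_apply ℝ _

theorem HasCompactSupport.covariantDeriv {j : Fin 2} {A : Plane → ℝ} {ψ : Plane → Spinor}
    (hψ : HasCompactSupport ψ) : HasCompactSupport (covariantDeriv j A ψ) :=
  ((hψ.partialDeriv j).smul_left (f := fun _ => -Complex.I)).sub
    (hψ.smul_left (f := fun p => (A p : ℂ)))

theorem continuous_apply_vecCons {A₁ A₂ : Plane → ℝ} (h₁ : Continuous A₁) (h₂ : Continuous A₂)
    (j : Fin 2) : Continuous (![A₁, A₂] j) := by
  fin_cases j <;> simpa

theorem continuous_diracExpr {A₁ A₂ : Plane → ℝ} (h₁ : Continuous A₁) (h₂ : Continuous A₂)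
    {ψ : Plane → Spinor} (hψ : ContDiff ℝ 1 ψ) : Continuous (diracExpr A₁ A₂ ψ) := by
  rw [show diracExpr A₁ A₂ ψ = _ from funext (diracExpr_eq_sum A₁ A₂ ψ)]
  exact continuous_finsetSum _ fun j _ => (pauliMap j).continuous.comp
    (continuous_covariantDeriv (continuous_apply_vecCons h₁ h₂ j) hψ)

theorem HasCompactSupport.diracExpr {A₁ A₂ : Plane → ℝ} {ψ : Plane → Spinor}
    (hψ : HasCompactSupport ψ) : HasCompactSupport (diracExpr A₁ A₂ ψ) :=
  (hψ.covariantDeriv.comp_left (map_zero _)).add (hψ.covariantDeriv.comp_left (map_zero _))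

/-! ### Integration by parts and formal symmetry -/

/-- The derivative of a compactly supported `C¹` function has integral zero. -/
theorem integral_partialDeriv_eq_zero {h : Plane → ℂ} (hh : ContDiff ℝ 1 h)
    (hc : HasCompactSupport h) (j : Fin 2) : ∫ p, partialDeriv j h p = 0 := by
  have h₀ := hh.continuous.integrable_of_hasCompactSupport (μ := (volume : Measure Plane)) hc
  have h₁ := (continuous_partialDeriv j hh).integrable_of_hasCompactSupport
    (μ := (volume : Measure Plane)) (hc.partialDeriv j)
  have := integral_mul_fderiv_eq_neg_fderiv_mul_of_integrable (μ := (volume : Measure Plane))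
    (f := fun _ => (1 : ℂ)) (g := h) (v := EuclideanSpace.single j 1) (by simp)
    (by simp only [one_mul]; exact h₁) (by simpa using h₀)
    (by simp) (fun x _ => hh.differentiable (by simp) x)
  simpa [partialDeriv] using this

/-- Formal symmetry of the Dirac expression. -/
theorem integral_inner_diracExpr {A₁ A₂ : Plane → ℝ} (h₁ : Continuous A₁) (h₂ : Continuous A₂)
    {u ψ : Plane → Spinor} (hu : ContDiff ℝ 1 u) (hψ : ContDiff ℝ 1 ψ)
    (hψc : HasCompactSupport ψ) :
    ∫ p, ⟪diracExpr A₁ A₂ u p, ψ p⟫ = ∫ p, ⟪u p, diracExpr A₁ A₂ ψ p⟫ := by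
  have hi₁ : Integrable fun p => ⟪diracExpr A₁ A₂ u p, ψ p⟫ :=
    ((continuous_diracExpr h₁ h₂ hu).inner hψ.continuous).integrable_of_hasCompactSupport
      (hψc.mono' fun p hp => subset_tsupport _ (fun h0 => hp (by simp [h0])))
  have hi₂ : Integrable fun p => ⟪u p, diracExpr A₁ A₂ ψ p⟫ :=
    (hu.continuous.inner (continuous_diracExpr h₁ h₂ hψ)).integrable_of_hasCompactSupport
      ((hψc.diracExpr (A₁ := A₁) (A₂ := A₂)).mono' fun p hp =>
        subset_tsupport _ (fun h0 => hp (by simp [h0])))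
  rw [← sub_eq_zero, ← integral_sub hi₁ hi₂]
  have hS : ∀ j, ContDiff ℝ 1 fun p => pauliMap j (ψ p) := fun j =>
    ((pauliMap j).restrictScalars ℝ).contDiff.comp hψ
  have hh : ∀ j, ContDiff ℝ 1 fun p => ⟪u p, pauliMap j (ψ p)⟫ := fun j => hu.inner ℂ (hS j)
  have hc : ∀ j, HasCompactSupport fun p => ⟪u p, pauliMap j (ψ p)⟫ := fun j =>
    hψc.mono' fun p hp => subset_tsupport _ (fun h0 => hp (by simp [h0]))
  -- The difference is a divergence: the terms with `A` cancel because `A` is real and the Pauli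
  -- matrices are Hermitian.
  have key : ∀ p, ⟪diracExpr A₁ A₂ u p, ψ p⟫ - ⟪u p, diracExpr A₁ A₂ ψ p⟫ =
      ∑ j, Complex.I * partialDeriv j (fun p => ⟪u p, pauliMap j (ψ p)⟫) p := by
    intro p
    simp only [diracExpr_eq_sum, sum_inner, inner_sum, ← Finset.sum_sub_distrib]
    refine Finset.sum_congr rfl fun j _ => ?_
    have hf : fderiv ℝ (fun p => pauliMap j (ψ p)) p (EuclideanSpace.single j 1) =
        pauliMap j (partialDeriv j ψ p) := by
      have := ((pauliMap j).restrictScalars ℝ).hasFDerivAt.comp p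
        (hψ.differentiable (by simp) p).hasFDerivAt
      have h' := this.fderiv
      simp only [ContinuousLinearMap.coe_restrictScalars', Function.comp_def] at h'
      rw [h']; rfl
    rw [partialDeriv, fderiv_inner_apply ℂ (hu.differentiable (by simp) p)
      ((hS j).differentiable (by simp) p), hf, inner_pauliMap_left]
    simp only [covariantDeriv, map_sub, map_smul, inner_sub_left, inner_sub_right,
      inner_smul_left, inner_smul_right, ← partialDeriv.eq_1]
    simp only [map_neg, Complex.conj_I, Complex.conj_ofReal]
    ring
  simp only [key]
  rw [integral_finsetSum _ fun j _ => ((continuous_partialDeriv j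
    (hh j)).integrable_of_hasCompactSupport ((hc j).partialDeriv j)).const_mul _]
  simp [integral_const_mul, integral_partialDeriv_eq_zero (hh _) (hc _)]

/-! ### The minimal operator, its adjoint and its closure -/

theorem inner_toLp_toLp {f g : Plane → Spinor} (hf : MemLp f 2 (volume : Measure Plane))
    (hg : MemLp g 2 (volume : Measure Plane)) :
    ⟪hf.toLp f, hg.toLp g⟫ = ∫ p, ⟪f p, g p⟫ := by
  rw [L2.inner_def]
  refine integral_congr_ae ?_
  filter_upwards [hf.coeFn_toLp, hg.coeFn_toLp] with p hp hq
  rw [hp, hq]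

theorem inner_coe_toLp (u : SpinorL2) {g : Plane → Spinor}
    (hg : MemLp g 2 (volume : Measure Plane)) :
    ⟪u, hg.toLp g⟫ = ∫ p, ⟪u p, g p⟫ := by
  rw [L2.inner_def]
  refine integral_congr_ae ?_
  filter_upwards [hg.coeFn_toLp] with p hq
  rw [hq]

theorem diracMin_apply {A₁ A₂ : Plane → ℝ} (h₁ : Continuous A₁) (h₂ : Continuous A₂)
    (ψ : testSpinors) :
    diracMin A₁ A₂ h₁ h₂ ⟨testToL2 ψ, LinearMap.mem_range_self _ _⟩ =
      diracOnTest A₁ A₂ h₁ h₂ ψ := by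
  change diracOnTest A₁ A₂ h₁ h₂ ((LinearEquiv.ofInjective testToL2 testToL2_injective).symm _) = _
  congr 1
  exact (LinearEquiv.symm_apply_eq _).2 rfl

theorem mem_graph_diracMin {A₁ A₂ : Plane → ℝ} (h₁ : Continuous A₁) (h₂ : Continuous A₂)
    (ψ : testSpinors) :
    (testToL2 ψ, diracOnTest A₁ A₂ h₁ h₂ ψ) ∈ (diracMin A₁ A₂ h₁ h₂).graph := by
  rw [LinearPMap.mem_graph_iff]
  exact ⟨⟨testToL2 ψ, LinearMap.mem_range_self _ _⟩, rfl, diracMin_apply h₁ h₂ ψ⟩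

theorem dense_range_testToL2 : Dense (Set.range testToL2) := by
  refine (Lp.dense_hasCompactSupport_contDiff (F := Spinor) (μ := (volume : Measure Plane))
    (p := 2) (by simp)).mono ?_
  rintro f ⟨g, hfg, hg, hg'⟩
  refine ⟨⟨g, hg', hg⟩, ?_⟩
  exact Lp.ext ((testSpinors_memLp ⟨g, hg', hg⟩).coeFn_toLp.trans hfg.symm)

theorem dense_diracMin_domain {A₁ A₂ : Plane → ℝ} (h₁ : Continuous A₁) (h₂ : Continuous A₂) :
    Dense ((diracMin A₁ A₂ h₁ h₂).domain : Set SpinorL2) := by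
  exact dense_range_testToL2

/-- The adjoint is the maximal operator, given by the Dirac expression in the sense of
distributions. -/
theorem mem_graph_adjoint_diracMin_iff {A₁ A₂ : Plane → ℝ} (h₁ : Continuous A₁)
    (h₂ : Continuous A₂) {u v : SpinorL2} :
    (u, v) ∈ (diracMin A₁ A₂ h₁ h₂).adjoint.graph ↔
      ∀ ψ : testSpinors, ⟪v, testToL2 ψ⟫ = ⟪u, diracOnTest A₁ A₂ h₁ h₂ ψ⟫ := by
  constructor
  · intro h ψ
    obtain ⟨y, hy, hv⟩ := (LinearPMap.mem_graph_iff _).1 h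
    have := LinearPMap.adjoint_isFormalAdjoint (dense_diracMin_domain h₁ h₂) y
      ⟨testToL2 ψ, LinearMap.mem_range_self _ _⟩
    simp only at hy hv
    rw [diracMin_apply, hv, hy] at this
    exact this
  · intro h
    have h' : ∀ x : (diracMin A₁ A₂ h₁ h₂).domain,
        ⟪v, (x : SpinorL2)⟫ = ⟪u, diracMin A₁ A₂ h₁ h₂ x⟫ := by
      rintro ⟨x, ψ, rfl⟩
      rw [diracMin_apply]
      exact h ψ
    have hu := LinearPMap.mem_adjoint_domain_of_exists (T := diracMin A₁ A₂ h₁ h₂) u ⟨v, h'⟩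
    exact (LinearPMap.mem_graph_iff _).2 ⟨⟨u, hu⟩, rfl,
      LinearPMap.adjoint_apply_eq (dense_diracMin_domain h₁ h₂) ⟨u, hu⟩ h'⟩

theorem memLp_diracExpr {A₁ A₂ : Plane → ℝ} (h₁ : Continuous A₁) (h₂ : Continuous A₂)
    {u : Plane → Spinor} (hu : ContDiff ℝ 1 u) (huc : HasCompactSupport u) :
    MemLp (diracExpr A₁ A₂ u) 2 (volume : Measure Plane) :=
  (continuous_diracExpr h₁ h₂ hu).memLp_of_hasCompactSupport huc.diracExpr

/-- Compactly supported `C¹` spinor fields lie in the domain of the adjoint. -/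
theorem mem_graph_adjoint_of_contDiff {A₁ A₂ : Plane → ℝ} (h₁ : Continuous A₁)
    (h₂ : Continuous A₂) {u : Plane → Spinor} (hu : ContDiff ℝ 1 u) (huc : HasCompactSupport u) :
    ((hu.continuous.memLp_of_hasCompactSupport huc).toLp u,
      (memLp_diracExpr h₁ h₂ hu huc).toLp _) ∈ (diracMin A₁ A₂ h₁ h₂).adjoint.graph := by
  rw [mem_graph_adjoint_diracMin_iff]
  intro ψ
  refine (inner_toLp_toLp _ (testSpinors_memLp ψ)).trans
    (.trans ?_ (inner_toLp_toLp _ (diracExpr_memLp h₁ h₂ ψ)).symm)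
  exact integral_inner_diracExpr h₁ h₂ hu (ψ.2.1.of_le (by simp)) ψ.2.2

theorem diracMin_le_adjoint {A₁ A₂ : Plane → ℝ} (h₁ : Continuous A₁) (h₂ : Continuous A₂) :
    diracMin A₁ A₂ h₁ h₂ ≤ (diracMin A₁ A₂ h₁ h₂).adjoint := by
  refine LinearPMap.IsFormalAdjoint.le_adjoint (dense_diracMin_domain h₁ h₂) ?_
  rintro ⟨x, ψ, rfl⟩ ⟨y, χ, rfl⟩
  simp only [diracMin_apply]
  have hψ := mem_graph_adjoint_of_contDiff h₁ h₂ (ψ.2.1.of_le (by simp)) ψ.2.2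
  exact (mem_graph_adjoint_diracMin_iff h₁ h₂).1 hψ χ

theorem isClosable_diracMin {A₁ A₂ : Plane → ℝ} (h₁ : Continuous A₁) (h₂ : Continuous A₂) :
    (diracMin A₁ A₂ h₁ h₂).IsClosable :=
  LinearPMap.IsClosable.leIsClosable
    (LinearPMap.adjoint_isClosed (dense_diracMin_domain h₁ h₂)).isClosable
    (diracMin_le_adjoint h₁ h₂)

theorem diracOperator_eq_adjoint_of_le {A₁ A₂ : Plane → ℝ} (h₁ : Continuous A₁)
    (h₂ : Continuous A₂)
    (h : (diracMin A₁ A₂ h₁ h₂).adjoint.graph ≤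
      (diracMin A₁ A₂ h₁ h₂).graph.topologicalClosure) :
    diracOperator A₁ A₂ h₁ h₂ = (diracMin A₁ A₂ h₁ h₂).adjoint := by
  have hcl := isClosable_diracMin h₁ h₂
  refine LinearPMap.eq_of_eq_graph (le_antisymm ?_ ?_)
  · rw [diracOperator, ← hcl.graph_closure_eq_closure_graph]
    exact Submodule.topologicalClosure_minimal _
      (LinearPMap.le_graph_of_le (diracMin_le_adjoint h₁ h₂))
      (LinearPMap.adjoint_isClosed (dense_diracMin_domain h₁ h₂))
  · rwa [diracOperator, ← hcl.graph_closure_eq_closure_graph]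

/-- Write `T` for the minimal operator and `D` for its closure, so that `D = T*`. From `T ⊆ D`
follows `D* ⊆ T* = D`. Conversely `D ⊆ D*`, since the symmetry relation against test spinors is a
closed condition and passes to the closure of the graph. -/
theorem isSelfAdjoint_diracOperator_of_le {A₁ A₂ : Plane → ℝ} (h₁ : Continuous A₁)
    (h₂ : Continuous A₂)
    (h : (diracMin A₁ A₂ h₁ h₂).adjoint.graph ≤
      (diracMin A₁ A₂ h₁ h₂).graph.topologicalClosure) :
    IsSelfAdjoint (diracOperator A₁ A₂ h₁ h₂) := by
  have hcl := isClosable_diracMin h₁ h₂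
  have hd : Dense ((diracOperator A₁ A₂ h₁ h₂).domain : Set SpinorL2) :=
    (dense_diracMin_domain h₁ h₂).mono (LinearPMap.le_closure _).1
  have hm : ∀ u v : SpinorL2, (u, v) ∈ (diracOperator A₁ A₂ h₁ h₂).graph ↔
      ∀ ψ : testSpinors, ⟪v, testToL2 ψ⟫ = ⟪u, diracOnTest A₁ A₂ h₁ h₂ ψ⟫ := by
    rw [diracOperator_eq_adjoint_of_le h₁ h₂ h]
    exact fun u v => mem_graph_adjoint_diracMin_iff h₁ h₂
  have hgr : (diracMin A₁ A₂ h₁ h₂).graph.topologicalClosure =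
      (diracOperator A₁ A₂ h₁ h₂).graph := hcl.graph_closure_eq_closure_graph
  have hsymm : (diracOperator A₁ A₂ h₁ h₂).IsFormalAdjoint (diracOperator A₁ A₂ h₁ h₂) := by
    intro x y
    have hx := (diracOperator A₁ A₂ h₁ h₂).mem_graph x
    have hy := (diracOperator A₁ A₂ h₁ h₂).mem_graph y
    rw [hm] at hx
    rw [← hgr] at hy
    have hc : IsClosed {q : SpinorL2 × SpinorL2 |
        ⟪diracOperator A₁ A₂ h₁ h₂ x, q.1⟫ = ⟪(x : SpinorL2), q.2⟫} :=
      isClosed_eq (continuous_const.inner continuous_fst) (continuous_const.inner continuous_snd)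
    refine closure_minimal (fun q hq => ?_) hc hy
    obtain ⟨⟨_, ψ, rfl⟩, hq₁, hq₂⟩ := (LinearPMap.mem_graph_iff _).1 hq
    simp only [diracMin_apply] at hq₁ hq₂
    simp only [Set.mem_ofPred_eq, ← hq₁, ← hq₂]
    exact hx ψ
  rw [LinearPMap.isSelfAdjoint_def]
  refine le_antisymm ?_ (hsymm.le_adjoint hd)
  rw [← LinearPMap.le_graph_iff]
  rintro ⟨u, v⟩ huv
  rw [hm]
  intro ψ
  obtain ⟨y, hy, hv⟩ := (LinearPMap.mem_graph_iff _).1 huv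
  have hψ := LinearPMap.le_graph_of_le (LinearPMap.le_closure _) (mem_graph_diracMin h₁ h₂ ψ)
  obtain ⟨z, hz, hz'⟩ := (LinearPMap.mem_graph_iff _).1 hψ
  have := LinearPMap.adjoint_isFormalAdjoint hd y z
  simp only at hy hv hz hz'
  rw [← hv, ← hy, ← hz, ← hz']
  exact this

/-! ### Convergence, translation and averaging in `L²` -/

open Filter Topology ENNReal in
/-- Dominated convergence in `L²`. -/
theorem tendsto_toLp_of_dominated {α E : Type*} [MeasurableSpace α] {μ : Measure α}
    [NormedAddCommGroup E] {F : ℕ → α → E} {f : α → E} {g : α → ℝ}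
    (hF : ∀ n, MemLp (F n) 2 μ) (hf : MemLp f 2 μ) (hg : MemLp g 2 μ)
    (hb : ∀ n x, ‖F n x‖ ≤ g x) (hlim : ∀ x, Tendsto (fun n => F n x) atTop (𝓝 (f x))) :
    Tendsto (fun n => (hF n).toLp (F n)) atTop (𝓝 (hf.toLp f)) := by
  rw [Lp.tendsto_Lp_iff_tendsto_eLpNorm'']
  have hG : MemLp (fun x => g x + ‖f x‖) 2 μ := hg.add hf.norm
  have h₁ : ∫⁻ x, ‖g x + ‖f x‖‖ₑ ^ (2 : ℝ) ∂μ ≠ ⊤ := by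
    have := lintegral_rpow_enorm_lt_top_of_eLpNorm_lt_top (by simp) (by simp) hG.2
    simpa using this.ne
  have key : Tendsto (fun n => ∫⁻ x, ‖(F n - f) x‖ₑ ^ (2 : ℝ) ∂μ) atTop (𝓝 (∫⁻ _, 0 ∂μ)) := by
    refine tendsto_lintegral_of_dominated_convergence' (fun x => ‖g x + ‖f x‖‖ₑ ^ (2 : ℝ))
      (fun n => ((hF n).1.sub hf.1).enorm.pow_const _)
      (fun n => ae_of_all _ fun x => ?_) h₁ (ae_of_all _ fun x => ?_)
    · refine ENNReal.rpow_le_rpow ?_ zero_le_two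
      rw [enorm_le_iff_norm_le]
      refine (norm_sub_le _ _).trans ((add_le_add_left (hb n x) _).trans (Real.le_norm_self _))
    · have : Tendsto (fun n => ‖F n x - f x‖ₑ) atTop (𝓝 0) := by
        have := ((hlim x).sub_const (f x)).enorm
        simpa using this
      have h2 := (ENNReal.continuous_rpow_const (y := 2)).tendsto 0 |>.comp this
      simpa [Function.comp_def] using h2
  simp only [eLpNorm_eq_lintegral_rpow_enorm_toReal (two_ne_zero) ofNat_ne_top, toReal_ofNat]
  have h2 := (ENNReal.continuous_rpow_const (y := 1 / 2)).tendsto _ |>.comp key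
  simpa [Function.comp_def] using h2

/-- Translation is continuous in `L²`. -/
theorem exists_eLpNorm_translate_sub_le {E : Type*} [NormedAddCommGroup E]
    {u : Plane → E} (hu : MemLp u 2 (volume : Measure Plane)) {ε : ℝ} (hε : 0 < ε) :
    ∃ δ > 0, ∀ y : Plane, ‖y‖ < δ →
      eLpNorm (fun x => u (x - y) - u x) 2 volume ≤ ENNReal.ofReal ε := by
  let g : Plane → C(Plane, Plane) := fun y => ⟨fun x => x - y, by fun_prop⟩
  have hg : Continuous g := ContinuousMap.continuous_of_continuous_uncurry _ (by
    change Continuous fun q : Plane × Plane => q.2 - q.1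
    fun_prop)
  have hm : ∀ y, MeasurePreserving (g y) (volume : Measure Plane) volume := fun y =>
    measurePreserving_sub_right volume y
  have hc := (continuous_const (y := hu.toLp u)).compMeasurePreservingLp hg hm (by simp)
  obtain ⟨δ, hδ, h⟩ := Metric.continuous_iff.1 hc 0 ε hε
  refine ⟨δ, hδ, fun y hy => ?_⟩
  have h' := (h y (by simpa using hy)).le
  rw [Lp.toLp_compMeasurePreserving, Lp.toLp_compMeasurePreserving, dist_edist,
    Lp.edist_toLp_toLp, ← ENNReal.le_ofReal_iff_toReal_le _ hε.le] at h'
  · simpa [Pi.sub_def, g, Function.comp_def] using h'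
  · exact ((hu.comp_measurePreserving (hm y)).sub (hu.comp_measurePreserving (hm 0))).2.ne

open scoped Convolution in
/-- Averaging against a probability density moves an `L²` function by no more than the translations
in the support of the density do. -/
theorem eLpNorm_convolution_sub_le {E : Type*} [NormedAddCommGroup E] [NormedSpace ℝ E]
    [CompleteSpace E] {u : Plane → E} (hum : StronglyMeasurable u)
    (hul : LocallyIntegrable u volume) {η : Plane → ℝ} (hη : Continuous η)
    (hηc : HasCompactSupport η) (hη0 : ∀ t, 0 ≤ η t) (hη1 : ∫ t, η t = 1) {ε : ENNReal}
    (hε : ∀ y ∈ Function.support η, eLpNorm (fun x => u (x - y) - u x) 2 volume ≤ ε) :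
    eLpNorm ((η ⋆[ContinuousLinearMap.lsmul ℝ ℝ, volume] u) - u) 2 volume ≤ ε := by
  set ρ : Plane → ENNReal := fun t => ENNReal.ofReal (η t) with hρ
  have hρm : Measurable ρ := hη.measurable.ennreal_ofReal
  have hρ1 : ∫⁻ t, ρ t = 1 := by
    rw [hρ, ← ofReal_integral_eq_lintegral_ofReal (hη.integrable_of_hasCompactSupport hηc)
      (ae_of_all _ hη0), hη1, ENNReal.ofReal_one]
  have : IsProbabilityMeasure (volume.withDensity ρ) := ⟨by simp [withDensity_apply, hρ1]⟩
  have hmm : StronglyMeasurable fun q : Plane × Plane => u (q.1 - q.2) - u q.1 :=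
    (hum.comp_measurable (by fun_prop)).sub (hum.comp_measurable measurable_fst)
  -- Jensen's inequality for the probability measure `η dt`, in the form that the `L¹` norm is at
  -- most the `L²` norm. Tonelli then gives the claim.
  have hpt : ∀ x, ‖((η ⋆[ContinuousLinearMap.lsmul ℝ ℝ, volume] u) - u) x‖ₑ ^ (2 : ℝ) ≤
      ∫⁻ t, ρ t * ‖u (x - t) - u x‖ₑ ^ (2 : ℝ) := by
    intro x
    have hx : StronglyMeasurable fun t => u (x - t) - u x :=
      hmm.comp_measurable (measurable_const.prodMk measurable_id)
    have hex : Integrable (fun t => η t • u (x - t)) volume :=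
      hηc.convolutionExists_left (ContinuousLinearMap.lsmul ℝ ℝ) hη hul x
    have h1 : ((η ⋆[ContinuousLinearMap.lsmul ℝ ℝ, volume] u) - u) x =
        ∫ t, η t • (u (x - t) - u x) := by
      simp only [smul_sub]
      rw [integral_sub hex ((hη.integrable_of_hasCompactSupport hηc).smul_const _),
        integral_smul_const, hη1, one_smul]
      rfl
    have h2 : ‖((η ⋆[ContinuousLinearMap.lsmul ℝ ℝ, volume] u) - u) x‖ₑ ≤
        eLpNorm (fun t => u (x - t) - u x) 1 (volume.withDensity ρ) := by
      rw [h1, eLpNorm_one_eq_lintegral_enorm, lintegral_withDensity_eq_lintegral_mul _ hρm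
        hx.enorm]
      refine (enorm_integral_le_lintegral_enorm _).trans (lintegral_mono fun t => ?_)
      simp [enorm_smul, hρ, Real.enorm_of_nonneg (hη0 t)]
    have h3 := h2.trans (eLpNorm_le_eLpNorm_of_exponent_le (p := 1) (q := 2) (by simp)
      hx.aestronglyMeasurable)
    rw [eLpNorm_eq_lintegral_rpow_enorm_toReal two_ne_zero ENNReal.ofNat_ne_top,
      lintegral_withDensity_eq_lintegral_mul _ hρm (hx.enorm.pow_const _)] at h3
    refine (ENNReal.rpow_le_rpow h3 zero_le_two).trans ?_
    rw [← ENNReal.rpow_mul]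
    simp
  rw [eLpNorm_eq_lintegral_rpow_enorm_toReal two_ne_zero ENNReal.ofNat_ne_top,
    ENNReal.toReal_ofNat]
  have hsq : ∫⁻ x, ‖((η ⋆[ContinuousLinearMap.lsmul ℝ ℝ, volume] u) - u) x‖ₑ ^ (2 : ℝ) ≤
      ε ^ (2 : ℝ) := by
    refine (lintegral_mono hpt).trans ?_
    rw [lintegral_lintegral_swap]
    · have hle : ∀ t, ∫⁻ x, ρ t * ‖u (x - t) - u x‖ₑ ^ (2 : ℝ) ≤ ρ t * ε ^ (2 : ℝ) := by
        intro t
        by_cases ht : η t = 0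
        · simp [hρ, ht]
        have hxm : StronglyMeasurable fun x => u (x - t) - u x :=
          hmm.comp_measurable (measurable_id.prodMk measurable_const)
        rw [lintegral_const_mul _ (hxm.enorm.pow_const _)]
        gcongr
        have h := hε t ht
        rw [eLpNorm_eq_lintegral_rpow_enorm_toReal two_ne_zero ENNReal.ofNat_ne_top,
          ENNReal.toReal_ofNat] at h
        have h' := ENNReal.rpow_le_rpow h (z := 2) zero_le_two
        rw [← ENNReal.rpow_mul] at h'
        simpa using h'
      refine (lintegral_mono hle).trans ?_
      rw [lintegral_mul_const _ hρm, hρ1, one_mul]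
    · exact ((hρm.comp measurable_snd).mul (hmm.enorm.pow_const _)).aemeasurable
  refine (ENNReal.rpow_le_rpow hsq (by norm_num)).trans ?_
  rw [← ENNReal.rpow_mul]
  simp

/-! ### Distributional Dirac equation, mollification and cutoff -/

/-- `v` is the image of `u` under the Dirac expression in the sense of distributions. -/
def IsWeakDirac (A₁ A₂ : Plane → ℝ) (u v : Plane → Spinor) : Prop :=
  ∀ ψ : testSpinors, ∫ p, ⟪v p, (ψ : Plane → Spinor) p⟫ = ∫ p, ⟪u p, diracExpr A₁ A₂ ψ p⟫

theorem integrable_inner_of_memLp {u w : Plane → Spinor} (hu : MemLp u 2 (volume : Measure Plane))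
    (hw : Continuous w) (hwc : HasCompactSupport w) : Integrable fun p => ⟪u p, w p⟫ := by
  have hw' : MemLp w 2 (volume : Measure Plane) := hw.memLp_of_hasCompactSupport hwc
  refine (L2.integrable_inner (𝕜 := ℂ) (hu.toLp u) (hw'.toLp w)).congr ?_
  filter_upwards [hu.coeFn_toLp, hw'.coeFn_toLp] with p hp hq
  rw [hp, hq]

theorem continuous_diracCommutator {θ : Plane → ℝ} (hθ : ContDiff ℝ 1 θ) {ψ : Plane → Spinor}
    (hψ : Continuous ψ) : Continuous (diracCommutator θ ψ) :=
  continuous_finsetSum _ fun j _ => (continuous_const.mul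
    (Complex.continuous_ofReal.comp (continuous_partialDeriv j hθ))).smul
      ((pauliMap j).continuous.comp hψ)

/-- The test spinor `θψ` is inserted in the weak equation; the commutator that appears is skew and
moves over to `u`. -/
theorem IsWeakDirac.smul {A₁ A₂ : Plane → ℝ} (h₁ : Continuous A₁) (h₂ : Continuous A₂)
    {u v : Plane → Spinor} (hu : MemLp u 2 (volume : Measure Plane))
    (hv : MemLp v 2 (volume : Measure Plane)) (h : IsWeakDirac A₁ A₂ u v) {θ : Plane → ℝ}
    (hθ : ContDiff ℝ ∞ θ) :
    IsWeakDirac A₁ A₂ (fun p => (θ p : ℂ) • u p)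
      (fun p => (θ p : ℂ) • v p + diracCommutator θ u p) := by
  intro ψ
  have hθψ : (fun p => (θ p : ℂ) • (ψ : Plane → Spinor) p) ∈ testSpinors := by
    refine ⟨(Complex.ofRealCLM.contDiff.comp hθ).smul ψ.2.1,
      ψ.2.2.smul_left (f := fun p => (θ p : ℂ))⟩
  have h' := h ⟨_, hθψ⟩
  simp only at h'
  have hi₁ := integrable_inner_of_memLp hv hθψ.1.continuous hθψ.2
  have hi₂ : Integrable fun p => ⟪u p, diracCommutator θ ψ p⟫ :=
    integrable_inner_of_memLp hu (continuous_diracCommutator (hθ.of_le (by simp)) ψ.2.1.continuous)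
      (ψ.2.2.mono' fun p hp => subset_tsupport _ fun h0 => hp (by simp [diracCommutator, h0]))
  have hi₃ := integrable_inner_of_memLp hu
    (continuous_diracExpr h₁ h₂ (hθψ.1.of_le (by simp))) (hθψ.2.diracExpr (A₁ := A₁) (A₂ := A₂))
  calc ∫ p, ⟪(θ p : ℂ) • v p + diracCommutator θ u p, (ψ : Plane → Spinor) p⟫
      = ∫ p, (⟪v p, (θ p : ℂ) • (ψ : Plane → Spinor) p⟫ - ⟪u p, diracCommutator θ ψ p⟫) := by
        refine integral_congr_ae (ae_of_all _ fun p => ?_)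
        simp only [inner_add_left, inner_diracCommutator_left, inner_smul_left, inner_smul_right,
          Complex.conj_ofReal]
        ring
    _ = ∫ p, (⟪u p, diracExpr A₁ A₂ (fun p => (θ p : ℂ) • (ψ : Plane → Spinor) p) p⟫ -
          ⟪u p, diracCommutator θ ψ p⟫) := by
        rw [integral_sub hi₁ hi₂, h', ← integral_sub hi₃ hi₂]
    _ = _ := by
        refine integral_congr_ae (ae_of_all _ fun p => ?_)
        simp only
        rw [diracExpr_smul (hθ.differentiable (by simp) p) (ψ.2.1.differentiable (by simp) p)]
        simp only [inner_add_right, inner_smul_left, inner_smul_right, Complex.conj_ofReal,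
          add_sub_cancel_right]

/-- The zeroth order term `σ · A` of the Dirac expression. -/
def pauliField (A₁ A₂ : Plane → ℝ) (ψ : Plane → Spinor) (p : Plane) : Spinor :=
  ∑ j, (![A₁, A₂] j p : ℂ) • pauliMap j (ψ p)

theorem diracExpr_eq_sub_pauliField (A₁ A₂ : Plane → ℝ) (ψ : Plane → Spinor) (p : Plane) :
    diracExpr A₁ A₂ ψ p = diracExpr 0 0 ψ p - pauliField A₁ A₂ ψ p := by
  simp only [diracExpr_eq_sum, pauliField, covariantDeriv, ← Finset.sum_sub_distrib]
  refine Finset.sum_congr rfl fun j _ => ?_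
  have h0 : ![(0 : Plane → ℝ), 0] j p = 0 := by fin_cases j <;> rfl
  simp [h0, map_sub]

theorem inner_pauliField_left (A₁ A₂ : Plane → ℝ) (u ψ : Plane → Spinor) (p : Plane) :
    ⟪pauliField A₁ A₂ u p, ψ p⟫ = ⟪u p, pauliField A₁ A₂ ψ p⟫ := by
  simp only [pauliField, sum_inner, inner_sum, inner_smul_left, inner_smul_right,
    inner_pauliMap_left, Complex.conj_ofReal]

theorem norm_pauliField_le (A₁ A₂ : Plane → ℝ) (ψ : Plane → Spinor) (p : Plane) :
    ‖pauliField A₁ A₂ ψ p‖ ≤ (|A₁ p| + |A₂ p|) * ‖ψ p‖ := by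
  refine (norm_sum_le _ _).trans ?_
  simp [Fin.sum_univ_two, norm_smul, norm_pauliMap_apply, add_mul]

theorem continuous_pauliField {A₁ A₂ : Plane → ℝ} (h₁ : Continuous A₁) (h₂ : Continuous A₂)
    {ψ : Plane → Spinor} (hψ : Continuous ψ) : Continuous (pauliField A₁ A₂ ψ) :=
  continuous_finsetSum _ fun j _ => (Complex.continuous_ofReal.comp
    (continuous_apply_vecCons h₁ h₂ j)).smul ((pauliMap j).continuous.comp hψ)

theorem stronglyMeasurable_pauliField {A₁ A₂ : Plane → ℝ} (h₁ : Continuous A₁)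
    (h₂ : Continuous A₂) {ψ : Plane → Spinor} (hψ : StronglyMeasurable ψ) :
    StronglyMeasurable (pauliField A₁ A₂ ψ) :=
  Finset.stronglyMeasurable_fun_sum _ fun j _ => (Complex.continuous_ofReal.comp
    (continuous_apply_vecCons h₁ h₂ j)).stronglyMeasurable.smul
      ((pauliMap j).continuous.comp_stronglyMeasurable hψ)

/-- Reduces to constant coefficients, where the operator commutes with convolution. -/
theorem IsWeakDirac.add_pauliField {A₁ A₂ : Plane → ℝ} (h₁ : Continuous A₁) (h₂ : Continuous A₂)
    {u v : Plane → Spinor} (hu : MemLp u 2 (volume : Measure Plane))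
    (hv : MemLp v 2 (volume : Measure Plane)) (h : IsWeakDirac A₁ A₂ u v) :
    IsWeakDirac 0 0 u (fun p => v p + pauliField A₁ A₂ u p) := by
  intro ψ
  have hi₁ := integrable_inner_of_memLp hv ψ.2.1.continuous ψ.2.2
  have hi₂ : Integrable fun p => ⟪u p, pauliField A₁ A₂ ψ p⟫ :=
    integrable_inner_of_memLp hu (continuous_pauliField h₁ h₂ ψ.2.1.continuous)
      (ψ.2.2.mono' fun p hp => subset_tsupport _ fun h0 => hp (by simp [pauliField, h0]))
  have hi₃ := integrable_inner_of_memLp hu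
    (continuous_diracExpr h₁ h₂ (ψ.2.1.of_le (by simp))) (ψ.2.2.diracExpr (A₁ := A₁) (A₂ := A₂))
  simp only [inner_add_left, inner_pauliField_left]
  rw [integral_add hi₁ hi₂, h ψ, ← integral_add hi₃ hi₂]
  simp only [diracExpr_eq_sub_pauliField A₁ A₂, inner_sub_right, sub_add_cancel]

open scoped Convolution in
theorem partialDeriv_convolution {η : Plane → ℝ} (hη : ContDiff ℝ 1 η)
    (hηc : HasCompactSupport η) {u : Plane → Spinor} (hu : LocallyIntegrable u volume)
    (j : Fin 2) (x : Plane) :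
    partialDeriv j (η ⋆[ContinuousLinearMap.lsmul ℝ ℝ, volume] u) x =
      ∫ t, partialDeriv j η (x - t) • u t := by
  rw [partialDeriv, (hηc.hasFDerivAt_convolution_left _ hη hu x).fderiv, convolution_eq_swap,
    ContinuousLinearMap.integral_apply]
  · rfl
  · have := (hηc.fderiv ℝ).convolutionExists_left
      ((ContinuousLinearMap.lsmul ℝ ℝ).precompL Plane) (hη.continuous_fderiv (by simp)) hu x
    exact (convolutionExistsAt_iff_integrable_swap).1 this

open scoped Convolution in
theorem IsWeakDirac.diracExpr_convolution {u w : Plane → Spinor}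
    (hu : LocallyIntegrable u volume) (hw : LocallyIntegrable w volume)
    (h : IsWeakDirac 0 0 u w) {η : Plane → ℝ} (hη : ContDiff ℝ ∞ η) (hηc : HasCompactSupport η)
    (x : Plane) :
    diracExpr 0 0 (η ⋆[ContinuousLinearMap.lsmul ℝ ℝ, volume] u) x =
      (η ⋆[ContinuousLinearMap.lsmul ℝ ℝ, volume] w) x := by
  have hη1 : ContDiff ℝ 1 η := hη.of_le (by simp)
  have hsub : ∀ (f : Plane → ℝ), HasCompactSupport f → HasCompactSupport fun t => f (x - t) :=
    fun f hf => hf.comp_homeomorph (Homeomorph.subLeft x)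
  have hint : ∀ (f : Plane → ℝ) (g : Plane → Spinor), Continuous f → HasCompactSupport f →
      LocallyIntegrable g volume → Integrable (fun t => f (x - t) • g t) volume :=
    fun f g hf hfc hg => hg.integrable_smul_left_of_hasCompactSupport
      (hf.comp (continuous_const.sub continuous_id)) (hsub f hfc)
  refine ext_inner_left ℂ fun e => ?_
  -- Testing the weak equation against `η(x - ·) e` reads off the component along `e` of the
  -- convolution at `x`.
  have hψ : (fun t => ((η (x - t) : ℝ) : ℂ) • e) ∈ testSpinors :=
    ⟨(Complex.ofRealCLM.contDiff.comp (hη.comp (contDiff_const.sub contDiff_id))).smul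
      contDiff_const, (hsub η hηc).comp_left (g := fun r : ℝ => (r : ℂ) • e) (by simp)⟩
  -- Conjugation puts the test spinor in the first slot, so that the pairing is linear in `u` and
  -- `w`.
  have h' := congrArg (starRingEnd ℂ) (h ⟨_, hψ⟩)
  simp only [← integral_conj, inner_conj_symm] at h'
  have hpd : ∀ j t, partialDeriv j (fun t => ((η (x - t) : ℝ) : ℂ) • e) t =
      -((partialDeriv j η (x - t) : ℝ) : ℂ) • e := by
    intro j t
    have h1 : HasFDerivAt (fun t => η (x - t)) (-(fderiv ℝ η (x - t))) t := by
      have := (hη1.differentiable (by simp) (x - t)).hasFDerivAt.comp t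
        ((hasFDerivAt_id t).const_sub x)
      simpa using! this
    have h2 := h1.smul_const e
    have h3 : (fun t => ((η (x - t) : ℝ) : ℂ) • e) = fun t => η (x - t) • e := by
      funext t; exact Complex.coe_smul _ _
    rw [partialDeriv, h3, h2.fderiv]
    simp [partialDeriv, ← Complex.coe_smul]
  have hpf : ∀ t, ⟪diracExpr 0 0 (fun t => ((η (x - t) : ℝ) : ℂ) • e) t, u t⟫ =
      ⟪e, ∑ j, (-Complex.I) • pauliMap j (partialDeriv j η (x - t) • u t)⟫ := by
    intro t
    rw [diracExpr_eq_sum, sum_inner, inner_sum]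
    refine Finset.sum_congr rfl fun j _ => ?_
    have h0 : ![(0 : Plane → ℝ), 0] j t = 0 := by fin_cases j <;> rfl
    simp only [covariantDeriv, hpd, h0, inner_pauliMap_left, ← Complex.coe_smul, map_smul]
    simp [inner_smul_right]
    rw [← Complex.coe_smul, inner_smul_right]
    ring
  rw [convolution_eq_swap]
  have hi := hint η w hη.continuous hηc hw
  have hj := fun j => hint (partialDeriv j η) u (continuous_partialDeriv j hη1)
    (hηc.partialDeriv j) hu
  have hL : ⟪e, ∫ t, ContinuousLinearMap.lsmul ℝ ℝ (η (x - t)) (w t)⟫ =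
      ∫ t, ⟪((η (x - t) : ℝ) : ℂ) • e, w t⟫ := by
    change ⟪e, ∫ t, η (x - t) • w t⟫ = _
    rw [← integral_inner (𝕜 := ℂ) hi]
    refine integral_congr_ae (ae_of_all _ fun t => ?_)
    simp [← Complex.coe_smul, inner_smul_right, mul_comm]
  rw [hL, h']
  simp only [hpf]
  have hk : ∀ j, Integrable fun t =>
      (-Complex.I) • pauliMap j (partialDeriv j η (x - t) • u t) := fun j =>
    Integrable.smul (-Complex.I) ((pauliMap j).integrable_comp (hj j))
  rw [integral_inner (𝕜 := ℂ) (integrable_finsetSum _ fun j _ => hk j),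
    integral_finsetSum _ fun j _ => hk j, diracExpr_eq_sum]
  congr 1
  refine Finset.sum_congr rfl fun j _ => ?_
  have h0 : ![(0 : Plane → ℝ), 0] j x = 0 := by fin_cases j <;> rfl
  rw [covariantDeriv, partialDeriv_convolution hη1 hηc hu, h0, integral_smul,
    ContinuousLinearMap.integral_comp_comm _ (hj j)]
  simp

open scoped Convolution in
/-- Friedrichs mollification: a compactly supported distributional pair is a limit of test
spinors in the graph norm. -/
theorem IsWeakDirac.exists_testSpinor_approx {A₁ A₂ : Plane → ℝ} (h₁ : Continuous A₁)
    (h₂ : Continuous A₂) {u v : Plane → Spinor} (hu : MemLp u 2 (volume : Measure Plane))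
    (hv : MemLp v 2 (volume : Measure Plane)) (hum : StronglyMeasurable u)
    (hvm : StronglyMeasurable v) (h : IsWeakDirac A₁ A₂ u v) {r : ℝ}
    (hr : ∀ p, r < ‖p‖ → u p = 0) {ε : ℝ} (hε : 0 < ε) :
    ∃ ψ : testSpinors, eLpNorm ((ψ : Plane → Spinor) - u) 2 volume ≤ ENNReal.ofReal ε ∧
      eLpNorm (diracExpr A₁ A₂ ψ - v) 2 volume ≤ ENNReal.ofReal ε := by
  -- The mollifier will have radius at most `1`, so `u` and its mollification both live in the ball
  -- of radius `r + 1`.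
  obtain ⟨M₀, hM₀⟩ := (isCompact_closedBall (0 : Plane) (r + 1)).exists_bound_of_continuousOn
    (f := fun p => |A₁ p| + |A₂ p|) (h₁.abs.add h₂.abs).continuousOn
  set M := max M₀ 0
  have hM0 : 0 ≤ M := le_max_right _ _
  have hM : ∀ p : Plane, ‖p‖ ≤ r + 1 → |A₁ p| + |A₂ p| ≤ M := fun p hp =>
    ((Real.le_norm_self _).trans (hM₀ p (by simpa using hp))).trans (le_max_left _ _)
  have hfield : ∀ f : Plane → Spinor, (∀ p, r + 1 < ‖p‖ → f p = 0) →
      ∀ p, ‖pauliField A₁ A₂ f p‖ ≤ M * ‖f p‖ := by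
    intro f hf p
    refine (norm_pauliField_le A₁ A₂ f p).trans ?_
    rcases le_or_gt ‖p‖ (r + 1) with hp | hp
    · gcongr
      exact hM p hp
    · simp [hf p hp]
  set w : Plane → Spinor := fun p => v p + pauliField A₁ A₂ u p with hw_def
  have hpm := stronglyMeasurable_pauliField h₁ h₂ hum
  have hw : MemLp w 2 (volume : Measure Plane) :=
    hv.add (MemLp.of_le_mul hu hpm.aestronglyMeasurable
      (ae_of_all _ (hfield u fun p hp => hr p (by linarith))))
  have hwm : StronglyMeasurable w := hvm.add hpm
  have hul := hu.locallyIntegrable (by simp)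
  have hwl := hw.locallyIntegrable (by simp)
  -- The error consists of the mollification error of `w` and of `σ · A (ψ - u)`, hence is at most
  -- `ε' + M ε' = ε`.
  set ε' := ε / (M + 1) with hε'_def
  have hε' : 0 < ε' := by positivity
  have hε'M : ε' + M * ε' = ε := by rw [hε'_def]; field_simp; ring
  obtain ⟨δ₁, hδ₁, hu'⟩ := exists_eLpNorm_translate_sub_le hu hε'
  obtain ⟨δ₂, hδ₂, hw'⟩ := exists_eLpNorm_translate_sub_le hw hε'
  set δ := min 1 (min δ₁ δ₂)
  have hδ : 0 < δ := by positivity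
  let b : ContDiffBump (0 : Plane) := ⟨δ / 2, δ, by positivity, by linarith⟩
  set η := b.normed volume
  have hηs : Function.support η = Metric.ball 0 δ := b.support_normed_eq
  have hη : ContDiff ℝ ∞ η := b.contDiff_normed
  have hηc : HasCompactSupport η := b.hasCompactSupport_normed
  have huapx := eLpNorm_convolution_sub_le hum hul hη.continuous hηc b.nonneg_normed
    b.integral_normed (ε := ENNReal.ofReal ε') fun y hy => hu' y (by
      rw [hηs, mem_ball_zero_iff] at hy
      exact hy.trans_le ((min_le_right _ _).trans (min_le_left _ _)))
  have hwapx := eLpNorm_convolution_sub_le hwm hwl hη.continuous hηc b.nonneg_normed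
    b.integral_normed (ε := ENNReal.ofReal ε') fun y hy => hw' y (by
      rw [hηs, mem_ball_zero_iff] at hy
      exact hy.trans_le ((min_le_right _ _).trans (min_le_right _ _)))
  set ψ : Plane → Spinor := η ⋆[ContinuousLinearMap.lsmul ℝ ℝ, volume] u with hψ_def
  have huc : HasCompactSupport u := by
    refine HasCompactSupport.intro (isCompact_closedBall (0 : Plane) r) fun p hp => hr p ?_
    simpa using hp
  have hψ : ψ ∈ testSpinors :=
    ⟨hηc.contDiff_convolution_left (ContinuousLinearMap.lsmul ℝ ℝ) hη hul, hηc.convolution _ huc⟩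
  have hψ0 : ∀ p, r + 1 < ‖p‖ → (ψ - u) p = 0 := by
    intro p hp
    have hup : u p = 0 := hr p (by linarith)
    suffices hψp : ψ p = 0 by simp [hψp, hup]
    by_contra hne
    obtain ⟨y, hy, z, hz, rfl⟩ := Set.mem_add.1
      (support_convolution_subset (ContinuousLinearMap.lsmul ℝ ℝ) hne)
    rw [hηs, mem_ball_zero_iff] at hy
    have hz' : ‖z‖ ≤ r := by
      by_contra hz'
      exact hz (hr z (not_le.1 hz'))
    have := norm_add_le y z
    have : δ ≤ 1 := min_le_left _ _
    linarith
  refine ⟨⟨ψ, hψ⟩, huapx.trans (ENNReal.ofReal_le_ofReal (by nlinarith)), ?_⟩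
  have hwc : Continuous (η ⋆[ContinuousLinearMap.lsmul ℝ ℝ, volume] w) :=
    (hηc.contDiff_convolution_left (ContinuousLinearMap.lsmul ℝ ℝ) hη hwl).continuous
  have heq : diracExpr A₁ A₂ ψ - v = ((η ⋆[ContinuousLinearMap.lsmul ℝ ℝ, volume] w) - w) -
      pauliField A₁ A₂ (ψ - u) := by
    funext p
    have hlin : pauliField A₁ A₂ (ψ - u) p = pauliField A₁ A₂ ψ p - pauliField A₁ A₂ u p := by
      simp only [pauliField, Pi.sub_apply, map_sub, smul_sub, Finset.sum_sub_distrib]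
    simp only [Pi.sub_apply]
    rw [diracExpr_eq_sub_pauliField, hlin, hψ_def,
      (h.add_pauliField h₁ h₂ hu hv).diracExpr_convolution hul hwl hη hηc]
    simp only [hw_def]
    abel
  simp only [heq]
  have hpsi := stronglyMeasurable_pauliField h₁ h₂ (hψ.1.continuous.stronglyMeasurable.sub hum)
  refine (eLpNorm_sub_le (hwc.aestronglyMeasurable.sub hwm.aestronglyMeasurable)
    hpsi.aestronglyMeasurable (by simp)).trans ?_
  have hb := eLpNorm_le_mul_eLpNorm_of_ae_le_mul (μ := (volume : Measure Plane))
    (ae_of_all _ (hfield (ψ - u) hψ0)) 2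
  refine (add_le_add hwapx (hb.trans (mul_le_mul_right huapx _))).trans ?_
  rw [← ENNReal.ofReal_mul hM0, ← ENNReal.ofReal_add hε'.le (by positivity), hε'M]

theorem IsWeakDirac.toLp_mem_closure {A₁ A₂ : Plane → ℝ} (h₁ : Continuous A₁)
    (h₂ : Continuous A₂) {u v : Plane → Spinor} (hu : MemLp u 2 (volume : Measure Plane))
    (hv : MemLp v 2 (volume : Measure Plane)) (hum : StronglyMeasurable u)
    (hvm : StronglyMeasurable v) (h : IsWeakDirac A₁ A₂ u v) {r : ℝ}
    (hr : ∀ p, r < ‖p‖ → u p = 0) :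
    (hu.toLp u, hv.toLp v) ∈ (diracMin A₁ A₂ h₁ h₂).graph.topologicalClosure := by
  refine Metric.mem_closure_iff.2 fun ε hε => ?_
  obtain ⟨ψ, hψ₁, hψ₂⟩ := h.exists_testSpinor_approx h₁ h₂ hu hv hum hvm hr (half_pos hε)
  refine ⟨_, mem_graph_diracMin h₁ h₂ ψ, ?_⟩
  have hd : ∀ {f g : Plane → Spinor} (hf : MemLp f 2 (volume : Measure Plane))
      (hg : MemLp g 2 (volume : Measure Plane)),
      eLpNorm (g - f) 2 volume ≤ ENNReal.ofReal (ε / 2) → dist (hf.toLp f) (hg.toLp g) < ε := by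
    intro f g hf hg hle
    rw [dist_comm, dist_edist, Lp.edist_toLp_toLp]
    refine ((ENNReal.le_ofReal_iff_toReal_le (hg.sub hf).2.ne (by positivity)).1 hle).trans_lt ?_
    linarith
  rw [Prod.dist_eq]
  exact max_lt (hd hu (testSpinors_memLp ψ) hψ₁) (hd hv (diracExpr_memLp h₁ h₂ ψ) hψ₂)

-- The cutoffs `θ n` have gradients of order `1 / (n + 1)`, so the commutator terms vanish in the
-- limit. Each cut-off pair has bounded support and is covered by mollification.
open Filter Topology in
theorem adjoint_graph_le_closure {A₁ A₂ : Plane → ℝ} (h₁ : Continuous A₁) (h₂ : Continuous A₂) :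
    (diracMin A₁ A₂ h₁ h₂).adjoint.graph ≤
      (diracMin A₁ A₂ h₁ h₂).graph.topologicalClosure := by
  rintro ⟨u, v⟩ huv
  have h : IsWeakDirac A₁ A₂ u v := fun ψ =>
    (inner_coe_toLp v (testSpinors_memLp ψ)).symm.trans
      (((mem_graph_adjoint_diracMin_iff h₁ h₂).1 huv ψ).trans
        (inner_coe_toLp u (diracExpr_memLp h₁ h₂ ψ)))
  have hu := Lp.memLp u
  have hv := Lp.memLp v
  let b : ContDiffBump (0 : Plane) := ⟨1, 2, by norm_num, by norm_num⟩
  have hb1 : ContDiff ℝ 1 b := b.contDiff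
  obtain ⟨C, hC⟩ := (hb1.continuous_fderiv (by simp)).bounded_above_of_compact_support
    (b.hasCompactSupport.fderiv ℝ)
  have hC0 : 0 ≤ C := (norm_nonneg _).trans (hC 0)
  let θ : ℕ → Plane → ℝ := fun n p => b (((n : ℝ) + 1)⁻¹ • p)
  have hθ : ∀ n, ContDiff ℝ ∞ (θ n) := fun n => b.contDiff.comp (contDiff_const_smul _)
  have hθb : ∀ n p, |θ n p| ≤ 1 := fun n p => by
    rw [abs_of_nonneg b.nonneg]
    exact b.le_one
  have hθ0 : ∀ (n : ℕ) p, 2 * ((n : ℝ) + 1) < ‖p‖ → θ n p = 0 := fun n p hp => by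
    refine b.zero_of_le_dist ?_
    rw [dist_zero_right, norm_smul, Real.norm_of_nonneg (by positivity)]
    change 2 ≤ _
    rw [inv_mul_eq_div, le_div_iff₀ (by positivity)]
    exact hp.le
  have hθ1 : ∀ p, Tendsto (fun n => θ n p) atTop (𝓝 1) := fun p => by
    refine tendsto_const_nhds.congr' ?_
    obtain ⟨N, hN⟩ := exists_nat_ge ‖p‖
    filter_upwards [eventually_ge_atTop N] with n hn
    refine (b.one_of_mem_closedBall ?_).symm
    have hn' : (N : ℝ) ≤ n := by exact_mod_cast hn
    rw [mem_closedBall_zero_iff, norm_smul, Real.norm_of_nonneg (by positivity)]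
    change _ ≤ (1 : ℝ)
    rw [inv_mul_eq_div, div_le_one (by positivity)]
    linarith
  have hθd : ∀ n p, ‖fderiv ℝ (θ n) p‖ ≤ ((n : ℝ) + 1)⁻¹ * C := fun n p => by
    have hd : θ n = b ∘ fun p => ((n : ℝ) + 1)⁻¹ • p := rfl
    have h1 := ((hb1.differentiable (by simp) (((n : ℝ) + 1)⁻¹ • p)).hasFDerivAt.comp p
      ((hasFDerivAt_id p).const_smul ((n : ℝ) + 1)⁻¹)).fderiv
    have h2 : fderiv ℝ (θ n) p =
        ((n : ℝ) + 1)⁻¹ • fderiv ℝ b (((n : ℝ) + 1)⁻¹ • p) := by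
      rw [hd]
      refine h1.trans ?_
      ext x
      simp
    rw [h2, norm_smul, Real.norm_of_nonneg (by positivity)]
    gcongr
    exact hC _
  have hcomm : ∀ n p, ‖diracCommutator (θ n) u p‖ ≤ 2 * (((n : ℝ) + 1)⁻¹ * C) * ‖u p‖ :=
    fun n p => (norm_diracCommutator_le _ _ _).trans (by gcongr; exact hθd n p)
  have hinv : ∀ n : ℕ, ((n : ℝ) + 1)⁻¹ ≤ 1 := fun n =>
    inv_le_one_of_one_le₀ (by linarith [n.cast_nonneg (α := ℝ)])
  have hmu : ∀ n, StronglyMeasurable fun p => (θ n p : ℂ) • u p := fun n =>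
    (Complex.continuous_ofReal.comp (hθ n).continuous).stronglyMeasurable.smul
      (Lp.stronglyMeasurable u)
  have hmv : ∀ n, StronglyMeasurable fun p => (θ n p : ℂ) • v p + diracCommutator (θ n) u p := by
    intro n
    refine ((Complex.continuous_ofReal.comp (hθ n).continuous).stronglyMeasurable.smul
      (Lp.stronglyMeasurable v)).add (Finset.stronglyMeasurable_fun_sum _ fun j _ => ?_)
    exact (continuous_const.mul (Complex.continuous_ofReal.comp (continuous_partialDeriv j
      ((hθ n).of_le (by simp))))).stronglyMeasurable.smul
        ((pauliMap j).continuous.comp_stronglyMeasurable (Lp.stronglyMeasurable u))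
  have hbu : ∀ n p, ‖(θ n p : ℂ) • u p‖ ≤ ‖u p‖ := fun n p => by
    rw [norm_smul, Complex.norm_real]
    exact mul_le_of_le_one_left (norm_nonneg _) (hθb n p)
  have hbv : ∀ n p, ‖(θ n p : ℂ) • v p + diracCommutator (θ n) u p‖ ≤
      ‖v p‖ + 2 * C * ‖u p‖ := fun n p => by
    refine (norm_add_le _ _).trans (add_le_add ?_ ((hcomm n p).trans ?_))
    · rw [norm_smul, Complex.norm_real]
      exact mul_le_of_le_one_left (norm_nonneg _) (hθb n p)
    · gcongr
      exact mul_le_of_le_one_left hC0 (hinv n)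
  have hgv : MemLp (fun p => ‖v p‖ + 2 * C * ‖u p‖) 2 (volume : Measure Plane) :=
    hv.norm.add (hu.norm.const_mul _)
  have hmemu : ∀ n, MemLp (fun p => (θ n p : ℂ) • u p) 2 (volume : Measure Plane) := fun n =>
    hu.norm.mono' (hmu n).aestronglyMeasurable (ae_of_all _ (hbu n))
  have hmemv : ∀ n, MemLp (fun p => (θ n p : ℂ) • v p + diracCommutator (θ n) u p) 2
      (volume : Measure Plane) := fun n =>
    hgv.mono' (hmv n).aestronglyMeasurable (ae_of_all _ (hbv n))
  have hθ1' : ∀ p (x : Spinor), Tendsto (fun n => (θ n p : ℂ) • x) atTop (𝓝 x) := fun p x => by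
    have := (Complex.continuous_ofReal.tendsto 1 |>.comp (hθ1 p)).smul_const x
    simpa [Function.comp_def] using this
  have hcomm0 : ∀ p, Tendsto (fun n => diracCommutator (θ n) u p) atTop (𝓝 0) := fun p => by
    refine squeeze_zero_norm (fun n => hcomm n p) ?_
    have := (tendsto_one_div_add_atTop_nhds_zero_nat (𝕜 := ℝ)).const_mul (2 * C * ‖u p‖)
    rw [mul_zero] at this
    refine this.congr fun n => ?_
    rw [one_div]; ring
  have hlu := tendsto_toLp_of_dominated hmemu hu hu.norm hbu fun p => hθ1' p (u p)
  have hlv := tendsto_toLp_of_dominated hmemv hv hgv hbv fun p => by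
    simpa using (hθ1' p (v p)).add (hcomm0 p)
  rw [Lp.toLp_coeFn] at hlu hlv
  refine (Submodule.isClosed_topologicalClosure _).mem_of_tendsto (hlu.prodMk_nhds hlv)
    (Eventually.of_forall fun n => ?_)
  exact (h.smul h₁ h₂ hu hv (hθ n)).toLp_mem_closure h₁ h₂ (hmemu n) (hmemv n) (hmu n) (hmv n)
    (r := 2 * ((n : ℝ) + 1)) fun p hp => by simp [hθ0 n p hp]

theorem isSelfAdjoint_diracOperator {A₁ A₂ : Plane → ℝ} (h₁ : Continuous A₁)
    (h₂ : Continuous A₂) : IsSelfAdjoint (diracOperator A₁ A₂ h₁ h₂) :=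
  isSelfAdjoint_diracOperator_of_le h₁ h₂ (adjoint_graph_le_closure h₁ h₂)

/-- Compactly supported `C¹` spinor fields lie in the domain of the Dirac operator, which acts on
them by the Dirac expression. -/
theorem mem_graph_diracOperator_of_contDiff {A₁ A₂ : Plane → ℝ} (h₁ : Continuous A₁)
    (h₂ : Continuous A₂) {u : Plane → Spinor} (hu : ContDiff ℝ 1 u) (huc : HasCompactSupport u) :
    ((hu.continuous.memLp_of_hasCompactSupport huc).toLp u,
      (memLp_diracExpr h₁ h₂ hu huc).toLp _) ∈ (diracOperator A₁ A₂ h₁ h₂).graph := by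
  rw [diracOperator_eq_adjoint_of_le h₁ h₂ (adjoint_graph_le_closure h₁ h₂)]
  exact mem_graph_adjoint_of_contDiff h₁ h₂ hu huc

/-! ### Compact resolvent implies coercivity at infinity -/

theorem norm_toLp_sq {f : Plane → Spinor} (hf : MemLp f 2 (volume : Measure Plane)) :
    ‖hf.toLp f‖ ^ 2 = ∫ p, ‖f p‖ ^ 2 := by
  have h := inner_toLp_toLp hf hf
  simp only [inner_self_eq_norm_sq_to_K] at h
  have h' : ∫ p, ((‖f p‖ : ℂ)) ^ 2 = ((∫ p, ‖f p‖ ^ 2 : ℝ) : ℂ) := by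
    rw [← integral_complex_ofReal]
    simp
  refine Complex.ofReal_injective ?_
  rw [Complex.ofReal_pow]
  exact h.trans h'

open Filter Topology in
/-- If the Dirac operator has a compact resolvent, then it is arbitrarily coercive on spinor
fields supported far away from the origin. -/
theorem exists_forall_mul_integral_le {A₁ A₂ : Plane → ℝ} (h₁ : Continuous A₁)
    (h₂ : Continuous A₂) {z : ℂ} {R : SpinorL2 →L[ℂ] SpinorL2}
    (hR : IsResolventAt (diracOperator A₁ A₂ h₁ h₂) z R) (hRc : IsCompactOperator R)
    {C : ℝ} (hC : 0 ≤ C) :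
    ∃ N : ℕ, ∀ u : Plane → Spinor, ContDiff ℝ 1 u → HasCompactSupport u →
      (∀ p, ‖p‖ < N → u p = 0) →
      C ^ 2 * ∫ p, ‖u p‖ ^ 2 ≤ ∫ p, ‖diracExpr A₁ A₂ u p‖ ^ 2 := by
  by_contra! hcon
  choose u hu huc hu0 hlt using hcon
  set x : ℕ → SpinorL2 := fun n => ((hu n).continuous.memLp_of_hasCompactSupport (huc n)).toLp _
  set y : ℕ → SpinorL2 := fun n => (memLp_diracExpr h₁ h₂ (hu n) (huc n)).toLp _
  have hlt' : ∀ n, ‖y n‖ ^ 2 < (C * ‖x n‖) ^ 2 := fun n => by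
    rw [mul_pow, norm_toLp_sq, norm_toLp_sq]
    exact hlt n
  have hy : ∀ n, ‖y n‖ < C * ‖x n‖ := fun n =>
    lt_of_pow_lt_pow_left₀ 2 (by positivity) (hlt' n)
  -- The strict inequality in the negated claim excludes the zero vector, so normalization is
  -- possible.
  have hx : ∀ n, 0 < ‖x n‖ := fun n => by
    by_contra h0
    have h0' : ‖x n‖ = 0 := le_antisymm (not_lt.1 h0) (norm_nonneg _)
    have := hy n
    rw [h0', mul_zero] at this
    exact absurd this (norm_nonneg _).not_gt
  -- The normalized fields are images under `R` of a bounded sequence, hence have a norm-convergent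
  -- subsequence.
  have hRx : ∀ n, R (((‖x n‖⁻¹ : ℝ) : ℂ) • (y n - z • x n)) = ((‖x n‖⁻¹ : ℝ) : ℂ) • x n := by
    intro n
    obtain ⟨d, hd, hd'⟩ := (LinearPMap.mem_graph_iff _).1
      (mem_graph_diracOperator_of_contDiff h₁ h₂ (hu n) (huc n))
    have := hR.2 d
    simp only at hd hd'
    rw [hd, hd'] at this
    rw [map_smul]
    exact congrArg _ this
  have hbd : ∀ n, ((‖x n‖⁻¹ : ℝ) : ℂ) • (y n - z • x n) ∈ Metric.closedBall (0 : SpinorL2)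
      (C + ‖z‖) := by
    intro n
    rw [mem_closedBall_zero_iff, norm_smul, Complex.norm_real, norm_inv, norm_norm,
      inv_mul_le_iff₀ (hx n)]
    refine (norm_sub_le _ _).trans ?_
    rw [norm_smul]
    nlinarith [hy n]
  obtain ⟨K, hK, hsub⟩ := hRc.image_closedBall_subset_compact (f := R.toLinearMap) (C + ‖z‖)
  obtain ⟨a, -, φ, hφ, hlim⟩ := hK.tendsto_subseq
    (x := fun n => ((‖x n‖⁻¹ : ℝ) : ℂ) • x n) fun n => hsub ⟨_, hbd n, hRx n⟩
  have hnorm : ‖a‖ = 1 := by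
    refine tendsto_nhds_unique hlim.norm (tendsto_const_nhds.congr fun n => ?_)
    rw [Function.comp_apply, norm_smul, Complex.norm_real, norm_inv, norm_norm,
      inv_mul_cancel₀ (hx _).ne']
  -- The supports leave every compact set, so the limit is orthogonal to all test spinors; yet it
  -- has norm one.
  have ha : a = 0 := by
    refine dense_range_testToL2.eq_zero_of_inner_right ℂ ?_
    rintro _ ⟨ψ, rfl⟩
    refine tendsto_nhds_unique (tendsto_const_nhds.inner hlim) (tendsto_const_nhds.congr' ?_)
    obtain ⟨r, hr⟩ := ψ.2.2.isCompact.isBounded.subset_closedBall (0 : Plane)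
    obtain ⟨N, hN⟩ := exists_nat_gt r
    filter_upwards [hφ.tendsto_atTop.eventually_ge_atTop N] with n hn
    have h0 : ⟪x (φ n), testToL2 ψ⟫ = 0 := by
      refine (inner_toLp_toLp _ (testSpinors_memLp ψ)).trans ?_
      refine (integral_congr_ae (ae_of_all _ fun p => ?_)).trans (integral_zero _ _)
      by_cases hp : ‖p‖ < φ n
      · simp [hu0 _ p hp]
      · have hp' : (ψ : Plane → Spinor) p = 0 := by
          refine image_eq_zero_of_notMem_tsupport fun hmem => hp ?_
          have h3 := mem_closedBall_zero_iff.1 (hr hmem)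
          have h4 : (N : ℝ) ≤ φ n := by exact_mod_cast hn
          linarith
        simp [hp']
    rw [Function.comp_apply, inner_smul_right, inner_eq_zero_symm.1 h0, mul_zero]
  rw [ha, norm_zero] at hnorm
  exact zero_ne_one hnorm

/-! ### Exponential growth from a three-term inequality -/

open Filter Topology in
/-- A sequence that is strictly convex in a multiplicative sense and eventually increasing grows
exponentially. -/
theorem false_of_three_mul_le {F : ℕ → ℝ} {N d : ℕ} {K : ℝ} (hF : ∀ n, 0 ≤ F n)
    (h3 : ∀ k, N ≤ k → 3 * F (k + 1) ≤ F k + F (k + 2)) (h02 : F N ≤ F (N + 2))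
    (hpos : 0 < F (N + 2)) (hK : ∀ n, F n ≤ K * ((n : ℝ) + 1) ^ d) : False := by
  -- At the start, `3 F(N+1) ≤ 2 F(N+2)`, whence `F(N+3) ≥ (7/3) F(N+2)`; afterwards a factor `2`
  -- reproduces itself, as `3 - 1/2 ≥ 2`.
  have hdouble : ∀ k, 2 * F (N + 2 + k) ≤ F (N + 2 + (k + 1)) := by
    intro k
    induction k with
    | zero =>
      have e1 := h3 N le_rfl
      have e2 := h3 (N + 1) (by omega)
      have e3 := hF (N + 2)
      simp only [add_zero, zero_add, add_assoc, Nat.reduceAdd] at *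
      linarith
    | succ k ih =>
      have e1 := h3 (N + 2 + k) (by omega)
      have e3 := hF (N + 2 + k)
      simp only [add_assoc, Nat.reduceAdd] at *
      linarith
  have hpow : ∀ k, 2 ^ k * F (N + 2) ≤ F (N + 2 + k) := by
    intro k
    induction k with
    | zero => simp
    | succ k ih =>
      rw [pow_succ]
      linarith [hdouble k]
  have hlim := (tendsto_pow_const_div_const_pow_of_one_lt d (r := (2 : ℝ)) (by norm_num)).const_mul
    (K * 2 ^ (N + 3))
  rw [mul_zero] at hlim
  obtain ⟨n, hn, hn'⟩ := ((hlim.eventually_lt_const hpos).and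
    (eventually_ge_atTop (N + 3))).exists
  obtain ⟨k, rfl⟩ := Nat.exists_eq_add_of_le hn'
  have h := (hpow k).trans (hK _)
  rw [mul_div_assoc', div_lt_iff₀ (by positivity), pow_add (2 : ℝ) (N + 3) k] at hn
  have hc : (((N + 2 + k : ℕ) : ℝ) + 1) = ((N + 3 + k : ℕ) : ℝ) := by push_cast; ring
  rw [hc] at h
  have h2 : (0 : ℝ) < 2 ^ (N + 3) := by positivity
  nlinarith [mul_le_mul_of_nonneg_left h h2.le]

/-! ### Annuli and radial cutoffs -/

/-- The half-open annulus of inner radius `a` and outer radius `b`. -/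
def annulus (a b : ℝ) : Set Plane := {p | a ≤ ‖p‖ ∧ ‖p‖ < b}

theorem measurableSet_annulus (a b : ℝ) : MeasurableSet (annulus a b) :=
  (measurableSet_le measurable_const measurable_norm).inter
    (measurableSet_lt measurable_norm measurable_const)

theorem integrableOn_annulus {g : Plane → ℝ} (hg : Continuous g) (a b : ℝ) :
    IntegrableOn g (annulus a b) :=
  (hg.continuousOn.integrableOn_compact (isCompact_closedBall (0 : Plane) b)).mono_set
    fun p hp => by simpa using hp.2.le

theorem setIntegral_annulus_add {g : Plane → ℝ} (hg : Continuous g) {a b c : ℝ} (hab : a ≤ b)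
    (hbc : b ≤ c) :
    ∫ p in annulus a c, g p = (∫ p in annulus a b, g p) + ∫ p in annulus b c, g p := by
  rw [← setIntegral_union _ (measurableSet_annulus b c) (integrableOn_annulus hg a b)
    (integrableOn_annulus hg b c)]
  · congr 2
    ext p
    simp only [annulus, Set.mem_union, Set.mem_ofPred_eq]
    constructor
    · rintro ⟨h1, h2⟩
      rcases lt_or_ge ‖p‖ b with h | h
      · exact Or.inl ⟨h1, h⟩
      · exact Or.inr ⟨h, h2⟩
    · rintro (⟨h1, h2⟩ | ⟨h1, h2⟩)
      · exact ⟨h1, h2.trans_le hbc⟩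
      · exact ⟨hab.trans h1, h2⟩
  · exact Set.disjoint_left.2 fun p hp hq => absurd hp.2 (not_lt.2 hq.1)

theorem setIntegral_annulus_pos {g : Plane → ℝ} (hg : Continuous g) (hpos : ∀ p, 0 < g p)
    {a b : ℝ} (ha : 0 ≤ a) (hab : a < b) : 0 < ∫ p in annulus a b, g p := by
  rw [setIntegral_pos_iff_support_of_nonneg_ae (ae_of_all _ fun p => (hpos p).le)
    (integrableOn_annulus hg a b)]
  have hs : Function.support g = Set.univ := by
    ext p; simp [(hpos p).ne']
  rw [hs, Set.univ_inter]
  have ho : IsOpen {p : Plane | a < ‖p‖ ∧ ‖p‖ < b} :=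
    (isOpen_lt continuous_const continuous_norm).inter (isOpen_lt continuous_norm continuous_const)
  refine (ho.measure_pos volume ⟨EuclideanSpace.single 0 ((a + b) / 2), ?_⟩).trans_le
    (measure_mono fun p hp => ⟨hp.1.le, hp.2⟩)
  have hn : ‖(EuclideanSpace.single 0 ((a + b) / 2) : Plane)‖ = (a + b) / 2 := by
    rw [PiLp.norm_single, Real.norm_of_nonneg (by linarith)]
  rw [Set.mem_ofPred_eq, hn]
  constructor <;> linarith

theorem setIntegral_annulus_le {g : Plane → ℝ} {n : ℕ} {M : ℝ} (hM : 0 ≤ M)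
    (hgM : ∀ p, ‖p‖ < n + 1 → |g p| ≤ M) :
    ∫ p in annulus n (n + 1), g p ≤
      M * (volume.real (Metric.ball (0 : Plane) 1) * ((n : ℝ) + 1) ^ 2) := by
  have hsub : annulus n (n + 1) ⊆ Metric.ball (0 : Plane) ((n : ℝ) + 1) := fun p hp => by
    simpa using hp.2
  have hfin : volume (Metric.ball (0 : Plane) ((n : ℝ) + 1)) < ⊤ := measure_ball_lt_top
  refine (Real.le_norm_self _).trans ((norm_setIntegral_le_of_norm_le_const
    ((measure_mono hsub).trans_lt hfin) fun p hp => hgM p hp.2).trans ?_)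
  gcongr
  refine (measureReal_mono hsub hfin.ne).trans (le_of_eq ?_)
  rw [Measure.real, Measure.addHaar_ball _ _ (by positivity), ENNReal.toReal_mul,
    ENNReal.toReal_ofReal (by positivity)]
  simp [Measure.real, mul_comm]

/-- Smooth radial cutoffs to the annuli of width one, with uniformly bounded gradients. -/
theorem exists_radial_cutoff : ∃ L : ℝ, 0 < L ∧ ∀ n : ℕ, 2 ≤ n → ∃ χ : Plane → ℝ,
    ContDiff ℝ 1 χ ∧ (∀ p ∈ annulus n (n + 1), χ p = 1) ∧
    (∀ p, p ∉ annulus (n - 1) (n + 2) → χ p = 0) ∧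
    (∀ p, p ∉ annulus (n - 1) (n + 2) → fderiv ℝ χ p = 0) ∧ ∀ p, ‖fderiv ℝ χ p‖ ≤ L := by
  -- A profile equal to `1` on `[0, 1]` and vanishing outside `(-1, 2)`, to be evaluated at `‖p‖ -
  -- n`.
  let b : ContDiffBump (1 / 2 : ℝ) := ⟨1 / 2, 3 / 2, by norm_num, by norm_num⟩
  have hb : ContDiff ℝ 1 b := b.contDiff
  obtain ⟨K, hK⟩ := hb.lipschitzWith_of_hasCompactSupport b.hasCompactSupport (by simp)
  refine ⟨K + 1, by positivity, fun n hn => ?_⟩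
  have hn' : (2 : ℝ) ≤ n := by exact_mod_cast hn
  have hzero : ∀ p : Plane, ‖p‖ ≤ n - 1 ∨ (n : ℝ) + 2 ≤ ‖p‖ → b (‖p‖ - n) = 0 := by
    intro p hp
    refine b.zero_of_le_dist ?_
    change (3 / 2 : ℝ) ≤ _
    rw [Real.dist_eq, le_abs]
    rcases hp with hp | hp
    · right; linarith
    · left; linarith
  have hout : ∀ p : Plane, p ∉ annulus (n - 1) (n + 2) → b (‖p‖ - n) = 0 := by
    intro p hp
    refine hzero p ?_
    by_contra! h
    exact hp ⟨h.1.le, h.2⟩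
  refine ⟨fun p => b (‖p‖ - n), ?_, fun p hp => ?_, hout, fun p hp => ?_, fun p => ?_⟩
  · refine contDiff_iff_contDiffAt.2 fun p => ?_
    rcases eq_or_ne p 0 with rfl | hp
    -- Since `n ≥ 2`, the cutoff vanishes near the origin, where the norm is not smooth.
    · refine (contDiffAt_const (c := (0 : ℝ))).congr_of_eventuallyEq ?_
      filter_upwards [Metric.ball_mem_nhds (0 : Plane) one_pos] with q hq
      refine hzero q (Or.inl ?_)
      have := mem_ball_zero_iff.1 hq
      linarith
    · exact hb.contDiffAt.comp p ((contDiffAt_norm ℝ hp).sub contDiffAt_const)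
  · refine b.one_of_mem_closedBall ?_
    rw [Metric.mem_closedBall, Real.dist_eq, abs_le]
    change -(1 / 2 : ℝ) ≤ _ ∧ _ ≤ (1 / 2 : ℝ)
    have h1 := hp.1
    have h2 := hp.2
    constructor <;> linarith
  -- A zero of a nonnegative function is a minimum; this also covers boundary points of the annulus.
  · refine IsLocalMin.fderiv_eq_zero (Filter.Eventually.of_forall fun q => ?_)
    change b (‖p‖ - n) ≤ b (‖q‖ - n)
    rw [hout p hp]
    exact b.nonneg
  · have hl : LipschitzWith K fun p : Plane => b (‖p‖ - n) := by
      refine LipschitzWith.of_dist_le_mul fun p q => (hK.dist_le_mul _ _).trans ?_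
      gcongr
      rw [dist_sub_right, dist_eq_norm p q]
      exact dist_norm_norm_le p q
    exact (norm_fderiv_le_of_lipschitz ℝ hl).trans (by linarith)

/-! ### Gauge function and zero modes -/

theorem laplacian_eq_partialDeriv {φ : Plane → ℝ} (hφ : ContDiff ℝ 2 φ) (p : Plane) :
    Laplacian.laplacian φ p =
      partialDeriv 0 (partialDeriv 0 φ) p + partialDeriv 1 (partialDeriv 1 φ) p := by
  have h : ∀ j, partialDeriv j (partialDeriv j φ) p =
      iteratedFDeriv ℝ 2 φ p ![EuclideanSpace.single j 1, EuclideanSpace.single j 1] := by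
    intro j
    have hd : DifferentiableAt ℝ (fderiv ℝ φ) p :=
      (hφ.fderiv_right (m := 1) (by norm_num)).differentiable (by simp) p
    rw [iteratedFDeriv_two_apply]
    have h1 := (hd.hasFDerivAt.clm_apply
      (hasFDerivAt_const (EuclideanSpace.single j (1 : ℝ) : Plane) p)).fderiv
    have h2 : partialDeriv j (partialDeriv j φ) p = fderiv ℝ
      (fun q => fderiv ℝ φ q (EuclideanSpace.single j (1 : ℝ))) p (EuclideanSpace.single j 1) := rfl
    rw [h2, h1]
    simp
  rw [h, h, InnerProductSpace.laplacian_eq_iteratedFDeriv_orthonormalBasis φ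
    (EuclideanSpace.basisFun (Fin 2) ℝ)]
  simp [Fin.sum_univ_two]

theorem fderiv_eq_sum_partialDeriv (f : Plane → ℝ) (p x : Plane) :
    fderiv ℝ f p x = x 0 * partialDeriv 0 f p + x 1 * partialDeriv 1 f p := by
  have hx : x = x 0 • (EuclideanSpace.single 0 1 : Plane) + x 1 • EuclideanSpace.single 1 1 := by
    ext i; fin_cases i <;> simp
  conv_lhs => rw [hx]
  simp [partialDeriv]

/-- A gauge function: `A` differs from the divergence-free potential generated by `φ` by a
gradient. -/
theorem exists_gauge {A₁ A₂ φ : Plane → ℝ} (hA₁ : ContDiff ℝ 1 A₁) (hA₂ : ContDiff ℝ 1 A₂)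
    (hφ : ContDiff ℝ 2 φ) (hB : ∀ p, magneticField A₁ A₂ p = Laplacian.laplacian φ p) :
    ∃ γ : Plane → ℝ, ContDiff ℝ 1 γ ∧ (∀ p, partialDeriv 0 γ p = A₁ p + partialDeriv 1 φ p) ∧
      ∀ p, partialDeriv 1 γ p = A₂ p - partialDeriv 0 φ p := by
  have hd : ∀ j, ContDiff ℝ 1 (partialDeriv j φ) := fun j =>
    (hφ.fderiv_right (m := 1) (by norm_num)).clm_apply contDiff_const
  set a : Plane → ℝ := fun p => A₁ p + partialDeriv 1 φ p
  set c : Plane → ℝ := fun p => A₂ p - partialDeriv 0 φ p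
  have ha : ContDiff ℝ 1 a := hA₁.add (hd 1)
  have hc : ContDiff ℝ 1 c := hA₂.sub (hd 0)
  have had := ha.differentiable (by simp)
  have hcd := hc.differentiable (by simp)
  let π : Fin 2 → Plane →L[ℝ] ℝ := fun j => EuclideanSpace.proj j
  set form : Plane → Plane →L[ℝ] ℝ := fun p => a p • π 0 + c p • π 1
  have hform : ContDiff ℝ 1 form := (ha.smul contDiff_const).add (hc.smul contDiff_const)
  -- Closedness of the form `a dx + c dy` is exactly `B = Δφ`; the Poincaré lemma on the plane then
  -- yields `γ`.
  have hcurl : ∀ p, partialDeriv 1 a p = partialDeriv 0 c p := by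
    intro p
    have h1 : partialDeriv 1 a p = partialDeriv 1 A₁ p + partialDeriv 1 (partialDeriv 1 φ) p := by
      exact DFunLike.congr_fun (fderiv_fun_add (hA₁.differentiable (by simp) p)
        ((hd 1).differentiable (by simp) p)) _
    have h2 : partialDeriv 0 c p = partialDeriv 0 A₂ p - partialDeriv 0 (partialDeriv 0 φ) p := by
      exact DFunLike.congr_fun (fderiv_fun_sub (hA₂.differentiable (by simp) p)
        ((hd 0).differentiable (by simp) p)) _
    have h3 := hB p
    rw [laplacian_eq_partialDeriv hφ, magneticField] at h3
    rw [h1, h2]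
    linarith
  have hformd : ∀ p x y, fderiv ℝ form p x y = fderiv ℝ a p x * y 0 + fderiv ℝ c p x * y 1 := by
    intro p x y
    have := (((had p).hasFDerivAt.smul_const (π 0)).add
      ((hcd p).hasFDerivAt.smul_const (π 1))).fderiv
    have h' : fderiv ℝ form p = _ := this
    rw [h']
    simp [π]
  obtain ⟨γ, hγ⟩ := convex_univ.exists_forall_hasFDerivAt_of_fderiv_symmetric isOpen_univ
    (hform.differentiable (by simp)).differentiableOn (fun p _ x y => by
      rw [hformd, hformd]
      simp only [fderiv_eq_sum_partialDeriv]
      rw [hcurl p]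
      ring)
  have hγ' : ∀ p, HasFDerivAt γ (form p) p := fun p => hγ p (Set.mem_univ p)
  refine ⟨γ, contDiff_one_iff_fderiv.2 ⟨fun p => (hγ' p).differentiableAt, ?_⟩, fun p => ?_,
    fun p => ?_⟩
  · rw [show fderiv ℝ γ = form from funext fun p => (hγ' p).fderiv]
    exact hform.continuous
  · rw [partialDeriv, (hγ' p).fderiv]
    simp [form, π, a]
  · rw [partialDeriv, (hγ' p).fderiv]
    simp [form, π, c]

/-- On a basis spinor `σ₂ = ±i σ₁`, so the Dirac equation becomes a scalar Cauchy–Riemann equation.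
-/
theorem pauliMap_one_single (k : Fin 2) :
    pauliMap 1 (EuclideanSpace.single k 1) =
      (((![1, -1] : Fin 2 → ℝ) k : ℂ) * Complex.I) • pauliMap 0 (EuclideanSpace.single k 1) := by
  rw [pauliMap_zero_apply, pauliMap_one_apply]
  ext i
  fin_cases k <;> fin_cases i <;> simp

theorem diracExpr_smul_single (A₁ A₂ : Plane → ℝ) {f : Plane → ℂ} {p : Plane}
    (hf : DifferentiableAt ℝ f p) (k : Fin 2) :
    diracExpr A₁ A₂ (fun q => f q • EuclideanSpace.single k (1 : ℂ)) p =
      ((-Complex.I * partialDeriv 0 f p - A₁ p * f p) + ((![1, -1] : Fin 2 → ℝ) k : ℂ) *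
        Complex.I * (-Complex.I * partialDeriv 1 f p - A₂ p * f p)) •
      pauliMap 0 (EuclideanSpace.single k 1) := by
  have hc : ∀ j A, covariantDeriv j A (fun q => f q • EuclideanSpace.single k (1 : ℂ)) p =
      (-Complex.I * partialDeriv j f p - A p * f p) • EuclideanSpace.single k (1 : ℂ) := by
    intro j A
    rw [covariantDeriv, partialDeriv, (hf.hasFDerivAt.smul_const _).fderiv]
    simp only [ContinuousLinearMap.smulRight_apply, smul_smul, sub_smul]
    rfl
  rw [diracExpr_eq_sum, Fin.sum_univ_two, hc, hc, map_smul, map_smul, pauliMap_one_single,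
    smul_smul, ← add_smul]
  simp only [Matrix.cons_val_zero, Matrix.cons_val_one]
  congr 1
  ring

/-- Zero modes of the Dirac expression with prescribed growth. -/
theorem exists_zeroMode {A₁ A₂ φ : Plane → ℝ} (hA₁ : ContDiff ℝ 1 A₁) (hA₂ : ContDiff ℝ 1 A₂)
    (hφ : ContDiff ℝ 2 φ) (hB : ∀ p, magneticField A₁ A₂ p = Laplacian.laplacian φ p)
    (k : Fin 2) (m : ℕ) :
    ∃ v : Plane → Spinor, ContDiff ℝ 1 v ∧ (∀ p, diracExpr A₁ A₂ v p = 0) ∧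
      ∀ p, ‖v p‖ ^ 2 = Real.exp (-2 * (![1, -1] : Fin 2 → ℝ) k * φ p) * ‖p‖ ^ (2 * m) := by
  obtain ⟨γ, hγ, hγ0, hγ1⟩ := exists_gauge hA₁ hA₂ hφ hB
  set s : ℝ := (![1, -1] : Fin 2 → ℝ) k with hs_def
  have hs : (s : ℂ) ^ 2 = 1 := by
    rw [hs_def]; fin_cases k <;> simp
  have hs' : s ^ 2 = 1 := by exact_mod_cast hs
  -- With `∂ = ∂_x + is ∂_y`, the scalar equation is `∂f = i(A₁ + isA₂) f`. The exponent satisfies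
  -- `∂h = i(A₁ + isA₂)`.
  let h : Plane → ℂ := fun p => Complex.I * (γ p : ℂ) - (s : ℂ) * (φ p : ℂ)
  -- Since `s² = 1`, `∂q = 0`; powers of `q` thus adjust the growth freely.
  let q : Plane → ℂ := fun p => ((p 0 : ℝ) : ℂ) + Complex.I * s * ((p 1 : ℝ) : ℂ)
  let f : Plane → ℂ := fun p => Complex.exp (h p) * q p ^ m
  have hof : ∀ {g : Plane → ℝ}, ContDiff ℝ 1 g → ContDiff ℝ 1 fun p => (g p : ℂ) := fun hg =>
    Complex.ofRealCLM.contDiff.comp hg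
  have hcoord : ∀ j, ContDiff ℝ 1 fun p : Plane => p j := fun j =>
    (EuclideanSpace.proj j : Plane →L[ℝ] ℝ).contDiff
  have hh : ContDiff ℝ 1 h :=
    (contDiff_const.mul (hof hγ)).sub (contDiff_const.mul (hof (hφ.of_le (by norm_num))))
  have hq : ContDiff ℝ 1 q := (hof (hcoord 0)).add (contDiff_const.mul (hof (hcoord 1)))
  have hf : ContDiff ℝ 1 f := hh.cexp.mul (hq.pow m)
  have hofd : ∀ {g : Plane → ℝ} (p : Plane), DifferentiableAt ℝ g p →
      HasFDerivAt (fun p => (g p : ℂ)) (Complex.ofRealCLM.comp (fderiv ℝ g p)) p :=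
    fun p hg => Complex.ofRealCLM.hasFDerivAt.comp p hg.hasFDerivAt
  have hdh : ∀ j p, partialDeriv j h p =
      Complex.I * (partialDeriv j γ p : ℝ) - s * (partialDeriv j φ p : ℝ) := by
    intro j p
    have h1 := ((hofd p (hγ.differentiable (by simp) p)).const_mul Complex.I).sub
      ((hofd p (hφ.differentiable (by simp) p)).const_mul (s : ℂ))
    have h2 : fderiv ℝ h p = _ := h1.fderiv
    rw [partialDeriv, h2]
    simp [partialDeriv]
  have hdq : ∀ j p, partialDeriv j q p = ![1, Complex.I * s] j := by
    intro j p
    have hc : ∀ i : Fin 2, HasFDerivAt (fun p : Plane => ((p i : ℝ) : ℂ))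
        (Complex.ofRealCLM.comp (EuclideanSpace.proj i)) p := fun i =>
      Complex.ofRealCLM.hasFDerivAt.comp p
        (EuclideanSpace.proj i : Plane →L[ℝ] ℝ).hasFDerivAt
    have h2 : fderiv ℝ q p = _ := ((hc 0).add ((hc 1).const_mul (Complex.I * s))).fderiv
    rw [partialDeriv, h2]
    fin_cases j <;> simp
  -- For `m = 0` the truncated exponent `m - 1` is harmless, because of the factor `m`.
  have hdf : ∀ j p, partialDeriv j f p = Complex.exp (h p) * partialDeriv j h p * q p ^ m +
      Complex.exp (h p) * (m * q p ^ (m - 1) * partialDeriv j q p) := by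
    intro j p
    have h1 := ((hh.differentiable (by simp) p).hasFDerivAt.cexp).mul
      ((hq.differentiable (by simp) p).hasFDerivAt.pow m)
    have h2 : fderiv ℝ f p = _ := h1.fderiv
    rw [partialDeriv, h2]
    simp [partialDeriv]
    ring
  refine ⟨fun p => f p • EuclideanSpace.single k (1 : ℂ), hf.smul contDiff_const, fun p => ?_,
    fun p => ?_⟩
  · rw [diracExpr_smul_single A₁ A₂ (hf.differentiable (by simp) p), hdf, hdf, hdh, hdh, hdq, hdq,
      hγ0, hγ1]
    simp only [Matrix.cons_val_zero, Matrix.cons_val_one, ← hs_def]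
    convert zero_smul ℂ _
    change _ - _ * (Complex.exp (h p) * q p ^ m) + _ * (_ - _ * (Complex.exp (h p) * q p ^ m)) = 0
    push_cast
    have hI := Complex.I_sq
    generalize Complex.exp (h p) = e
    generalize q p ^ m = Q
    generalize q p ^ (m - 1) = Q'
    linear_combination (-(A₁ p + (partialDeriv 1 φ p : ℝ)) * e * Q -
      s * Complex.I * (A₂ p - (partialDeriv 0 φ p : ℝ)) * e * Q + s ^ 2 * (partialDeriv 1 φ p : ℝ) * e * Q -
      s ^ 2 * Complex.I * e * m * Q') * hI +
      (-((partialDeriv 1 φ p : ℝ)) * e * Q + Complex.I * e * m * Q') * hs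
  · have h1 : ‖f p‖ = Real.exp (-s * φ p) * ‖q p‖ ^ m := by
      simp [f, h, Complex.norm_exp]
    have h2 : ‖q p‖ ^ 2 = ‖p‖ ^ 2 := by
      rw [EuclideanSpace.norm_sq_eq, ← Complex.normSq_eq_norm_sq, Complex.normSq_apply]
      simp [q, Fin.sum_univ_two]
      linear_combination (p 1) ^ 2 * hs'
    rw [norm_smul, h1, PiLp.norm_single, norm_one, mul_one, mul_pow, ← pow_mul, mul_comm m 2,
      pow_mul, h2, ← pow_mul, ← Real.exp_nat_mul]
    congr 2
    push_cast
    ring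

/-! ### The contradiction -/

/-- Cutting off a solution of the Dirac equation to an annulus. -/
theorem three_mul_setIntegral_annulus_le {A₁ A₂ : Plane → ℝ} {v : Plane → Spinor}
    (hv : ContDiff ℝ 1 v) (hDv : ∀ p, diracExpr A₁ A₂ v p = 0) {χ : Plane → ℝ}
    (hχ : ContDiff ℝ 1 χ) {L : ℝ} (hL : 0 < L) {n : ℝ}
    (hχ1 : ∀ p ∈ annulus n (n + 1), χ p = 1)
    (hχ0 : ∀ p, p ∉ annulus (n - 1) (n + 2) → χ p = 0)
    (hdχ0 : ∀ p, p ∉ annulus (n - 1) (n + 2) → fderiv ℝ χ p = 0)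
    (hdχ : ∀ p, ‖fderiv ℝ χ p‖ ≤ L)
    (hcoer : ∀ u : Plane → Spinor, ContDiff ℝ 1 u → HasCompactSupport u →
      (∀ p, ‖p‖ < n - 1 → u p = 0) →
      (4 * L) ^ 2 * ∫ p, ‖u p‖ ^ 2 ≤ ∫ p, ‖diracExpr A₁ A₂ u p‖ ^ 2) :
    3 * ∫ p in annulus n (n + 1), ‖v p‖ ^ 2 ≤
      (∫ p in annulus (n - 1) n, ‖v p‖ ^ 2) + ∫ p in annulus (n + 1) (n + 2), ‖v p‖ ^ 2 := by
  have hg : Continuous fun p => ‖v p‖ ^ 2 := hv.continuous.norm.pow 2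
  set u : Plane → Spinor := fun p => (χ p : ℂ) • v p with hu_def
  have hu : ContDiff ℝ 1 u := (Complex.ofRealCLM.contDiff.comp hχ).smul hv
  have hu0 : ∀ p, p ∉ annulus (n - 1) (n + 2) → u p = 0 := fun p hp => by
    simp [hu_def, hχ0 p hp]
  have huc : HasCompactSupport u := by
    refine HasCompactSupport.intro (isCompact_closedBall (0 : Plane) (n + 2)) fun p hp => ?_
    refine hu0 p fun hmem => hp ?_
    simpa using hmem.2.le
  have h := hcoer u hu huc fun p hp => hu0 p fun hmem => absurd hmem.1 (not_le.2 hp)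
  have hlow : ∫ p in annulus n (n + 1), ‖v p‖ ^ 2 ≤ ∫ p, ‖u p‖ ^ 2 := by
    have hi : Integrable fun p => ‖u p‖ ^ 2 :=
      (hu.continuous.norm.pow 2).integrable_of_hasCompactSupport
        (huc.mono' fun p hp => subset_tsupport _ fun h0 => hp (by simp [h0]))
    refine le_trans (le_of_eq ?_) (setIntegral_le_integral (s := annulus n (n + 1)) hi
      (ae_of_all _ fun p => by positivity))
    refine setIntegral_congr_fun (measurableSet_annulus _ _) fun p hp => ?_
    simp [hu_def, hχ1 p hp]
  have hupp : ∫ p, ‖diracExpr A₁ A₂ u p‖ ^ 2 ≤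
      (2 * L) ^ 2 * ∫ p in annulus (n - 1) (n + 2), ‖v p‖ ^ 2 := by
    rw [← integral_const_mul, ← integral_indicator (measurableSet_annulus _ _)]
    refine integral_mono_of_nonneg (ae_of_all _ fun p => by positivity)
      ((integrable_indicator_iff (measurableSet_annulus _ _)).2
        ((integrableOn_annulus hg _ _).const_mul _)) (ae_of_all _ fun p => ?_)
    have hDu : diracExpr A₁ A₂ u p = diracCommutator χ v p := by
      rw [hu_def, diracExpr_smul (hχ.differentiable (by simp) p) (hv.differentiable (by simp) p),
        hDv, smul_zero, zero_add]
    have hle := norm_diracCommutator_le χ v p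
    simp only [hDu]
    by_cases hp : p ∈ annulus (n - 1) (n + 2)
    · rw [Set.indicator_of_mem hp, ← mul_pow]
      refine pow_le_pow_left₀ (norm_nonneg _) (hle.trans ?_) 2
      gcongr
      exact hdχ p
    · rw [Set.indicator_of_notMem hp]
      rw [hdχ0 p hp, norm_zero, mul_zero, zero_mul] at hle
      simp [le_antisymm hle (norm_nonneg _)]
  rw [setIntegral_annulus_add hg (b := n) (by linarith) (by linarith),
    setIntegral_annulus_add hg (a := n) (b := n + 1) (by linarith) (by linarith)] at hupp
  -- The bounds combine to `16 L² F ≤ 4 L² (F₋ + F + F₊)`. Dividing by `4 L²` and absorbing the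
  -- middle term leaves the factor `3`.
  have hL2 : 0 < 4 * L ^ 2 := by positivity
  refine le_of_mul_le_mul_left ?_ hL2
  nlinarith [mul_le_mul_of_nonneg_left hlow (by positivity : 0 ≤ (4 * L) ^ 2)]

/-- A one-sided bound on the scalar potential excludes compact resolvents. -/
theorem not_isCompactOperator_of_le {A₁ A₂ φ : Plane → ℝ} (hA₁ : ContDiff ℝ 1 A₁)
    (hA₂ : ContDiff ℝ 1 A₂) (hφ : ContDiff ℝ 2 φ)
    (hB : ∀ p, magneticField A₁ A₂ p = Laplacian.laplacian φ p) (k : Fin 2) {M : ℝ}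
    (hM : ∀ p, -((![1, -1] : Fin 2 → ℝ) k * φ p) ≤ M) {z : ℂ} {R : SpinorL2 →L[ℂ] SpinorL2}
    (hR : IsResolventAt (diracOperator A₁ A₂ hA₁.continuous hA₂.continuous) z R) :
    ¬ IsCompactOperator R := by
  intro hRc
  obtain ⟨L, hL, hcut⟩ := exists_radial_cutoff
  obtain ⟨N₀, hN₀⟩ := exists_forall_mul_integral_le hA₁.continuous hA₂.continuous hR hRc
    (C := 4 * L) (by positivity)
  -- The cutoffs are centred at index `j + 1` with `j ≥ N`, and need that index to be at least `2`.
  set N := max N₀ 1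
  set W : Plane → ℝ := fun p => Real.exp (-2 * (![1, -1] : Fin 2 → ℝ) k * φ p)
  have hW : Continuous W := Real.continuous_exp.comp (continuous_const.mul hφ.continuous)
  have hW0 : ∀ p, 0 < W p := fun p => Real.exp_pos _
  have hWM : ∀ p, W p ≤ Real.exp (2 * M) := fun p =>
    Real.exp_le_exp.2 (by linarith [hM p])
  set a := ∫ p in annulus N (N + 1), W p
  set b := ∫ p in annulus (N + 2) (N + 3), W p
  have hb : 0 < b := setIntegral_annulus_pos hW hW0 (by positivity) (by linarith)
  -- The weight `|p|^(2m)` is at most `(N+1)^(2m)` on the annulus at `N` and at least `(N+2)^(2m)`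
  -- on the one at `N + 2`, so a large `m` outweighs the ratio `a / b`.
  obtain ⟨m, hm⟩ := pow_unbounded_of_one_lt (a / b) (y := (((N : ℝ) + 2) / (N + 1)) ^ 2)
    (one_lt_pow₀ (by rw [one_lt_div (by positivity)]; linarith) two_ne_zero)
  have hm' : ((N : ℝ) + 1) ^ (2 * m) * a ≤ ((N : ℝ) + 2) ^ (2 * m) * b := by
    rw [← pow_mul, div_pow, div_lt_div_iff₀ hb (by positivity)] at hm
    linarith
  obtain ⟨v, hv, hDv, hnv⟩ := exists_zeroMode hA₁ hA₂ hφ hB k m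
  have hg : Continuous fun p => ‖v p‖ ^ 2 := hv.continuous.norm.pow 2
  set F : ℕ → ℝ := fun n => ∫ p in annulus n (n + 1), ‖v p‖ ^ 2 with hF_def
  have hFN : F N ≤ ((N : ℝ) + 1) ^ (2 * m) * a := by
    rw [← integral_const_mul]
    refine setIntegral_mono_on (integrableOn_annulus hg _ _)
      ((integrableOn_annulus hW _ _).const_mul _) (measurableSet_annulus _ _) fun p hp => ?_
    rw [hnv, mul_comm]
    exact mul_le_mul_of_nonneg_right (pow_le_pow_left₀ (norm_nonneg _) hp.2.le _) (hW0 p).le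
  have hFN2 : ((N : ℝ) + 2) ^ (2 * m) * b ≤ F (N + 2) := by
    have hann : annulus ((N + 2 : ℕ) : ℝ) (((N + 2 : ℕ) : ℝ) + 1) = annulus (N + 2) (N + 3) := by
      push_cast
      congr 1
      ring
    simp only [hF_def, hann]
    rw [← integral_const_mul]
    refine setIntegral_mono_on ((integrableOn_annulus hW _ _).const_mul _)
      (integrableOn_annulus hg _ _) (measurableSet_annulus _ _) fun p hp => ?_
    rw [hnv, mul_comm]
    exact mul_le_mul_of_nonneg_left (pow_le_pow_left₀ (by positivity) hp.1 _) (hW0 p).le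
  -- The degree is `2m` from the weight plus `2` from the area of the enclosing ball.
  refine false_of_three_mul_le (F := F) (N := N) (d := 2 * m + 2)
    (K := Real.exp (2 * M) * volume.real (Metric.ball (0 : Plane) 1))
    (fun n => integral_nonneg fun p => by positivity) (fun j hj => ?_)
    (hFN.trans (hm'.trans hFN2)) (lt_of_lt_of_le (by positivity) hFN2) (fun n => ?_)
  · have hj1 : 1 ≤ j := (le_max_right _ _).trans hj
    obtain ⟨χ, hχ, hχ1, hχ0, hdχ0, hdχ⟩ := hcut (j + 1) (by omega)
    have h := three_mul_setIntegral_annulus_le hv hDv hχ hL hχ1 hχ0 hdχ0 hdχ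
      fun u hu huc hu0 => hN₀ u hu huc fun p hp => hu0 p (by
        have : (N₀ : ℝ) ≤ j := by exact_mod_cast (le_max_left _ _).trans hj
        push_cast
        linarith)
    have e1 : ((j + 1 : ℕ) : ℝ) - 1 = j := by push_cast; ring
    have e2 : ((j + 1 : ℕ) : ℝ) + 1 = ((j + 2 : ℕ) : ℝ) := by push_cast; ring
    have e3 : ((j + 1 : ℕ) : ℝ) + 2 = ((j + 2 : ℕ) : ℝ) + 1 := by push_cast; ring
    have e4 : ((j + 1 : ℕ) : ℝ) = (j : ℝ) + 1 := by push_cast; ring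
    rw [e1, e3, e2] at h
    simp only [hF_def, e2]
    rwa [e4] at h ⊢
  · refine (setIntegral_annulus_le (M := Real.exp (2 * M) * ((n : ℝ) + 1) ^ (2 * m))
      (by positivity) fun p hp => ?_).trans (le_of_eq (by ring))
    rw [abs_of_nonneg (by positivity), hnv]
    exact mul_le_mul (hWM p) (pow_le_pow_left₀ (norm_nonneg _) hp.le _) (by positivity)
      (by positivity)

end

theorem theorem1p1 (A₁ A₂ : Plane → ℝ) (hA₁ : ContDiff ℝ 1 A₁) (hA₂ : ContDiff ℝ 1 A₂)
    (hB : ∃ φ : Plane → ℝ, ContDiff ℝ 2 φ ∧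
      (∀ p, magneticField A₁ A₂ p = Laplacian.laplacian φ p) ∧
      (BddAbove (Set.range φ) ∨ BddBelow (Set.range φ))) :
    IsSelfAdjoint (diracOperator A₁ A₂ hA₁.continuous hA₂.continuous) ∧
      ∀ z ∉ unboundedSpectrum (diracOperator A₁ A₂ hA₁.continuous hA₂.continuous),
        ∀ R : SpinorL2 →L[ℂ] SpinorL2,
          IsResolventAt (diracOperator A₁ A₂ hA₁.continuous hA₂.continuous) z R →
            ¬ IsCompactOperator R := by
  refine ⟨isSelfAdjoint_diracOperator hA₁.continuous hA₂.continuous, fun z _ R hR => ?_⟩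
  obtain ⟨φ, hφ, hBφ, ⟨M, hM⟩ | ⟨M, hM⟩⟩ := hB
  -- For `φ` bounded above, the component `k = 1` has the bounded factor `exp(2φ)`; for `φ` bounded
  -- below, `k = 0` has `exp(-2φ)`.
  · refine not_isCompactOperator_of_le hA₁ hA₂ hφ hBφ 1 (M := M) (fun p => ?_) hR
    simpa using hM ⟨p, rfl⟩
  · refine not_isCompactOperator_of_le hA₁ hA₂ hφ hBφ 0 (M := -M) (fun p => ?_) hR
    simpa using hM ⟨p, rfl⟩
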